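/- Let $W/W_J$ be one of the Hermitian symmetric pairs $A_n/(A_{p-1}\times A_{n-p})$ ($1\le p\le n$), $C_n/A_{n-1}$ ($n\ge 2$), $B_n/B_{n-1}$ ($n\ge 2$), $D_n/A_{n-1}$ ($n\ge 3$), $D_n/D_{n-1}$ ($n\ge 3$), $E_6/D_5$, $E_7/E_6$. Here $W$ is the Weyl group of the given type with simple reflections $s_1,\dots,s_n$ in Bourbaki's numbering, and $J$ consists of all simple reflections except, respectively, $s_p,\ s_n,\ s_1,\ s_n,\ s_1,\ s_1,\ s_7$. Let $\ell$ be the length function and $W^J=\{w\in W:\ell(ws)>\ell(w)\text{ for all }s\in J\}$ the set of minimal length representatives of the cosets $wW_J$. The left weak order is generated by the relations $u<su$ with $s$ a simple reflection and $\ell(u)<\ell(su)$, the Bruhat order by the relations $u<tu$ with $t$ a reflection and $\ell(u)<\ell(tu)$; both are restricted from $W$ to $W^J$. The diagram of Hermitian type of the pair is the following set of boxes $(i,j)$ (row $i$ from the top, column $j$ from the left), each labelled by the index of a simple reflection. * $A_n/(A_{p-1}\times A_{n-p})$: $1\le i\le n+1-p$, $1\le j\le p$, with label $p+i-j$. * $C_n/A_{n-1}$: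 $1\le i\le j\le n$, with label $n+i-j$. * $B_n/B_{n-1}$: $(1,j)$ for $1\le j\le n$ with label $j$, and $(i,n)$ for $2\le i\le n$ with label $n+1-i$. * $D_n/A_{n-1}$: $1\le i\le j\le n-1$, where $(i,i)$ has label $n$ if $i$ is odd and $n-1$ if $i$ is even, and $(i,j)$ with $i<j$ has label $n-1+i-j$. * $D_n/D_{n-1}$: $(1,j)$ for $1\le j\le n-2$ with label $j$; $(1,n-1)$ with label $n$; $(2,n-2)$ with label $n-1$; and $(i,n-1)$ for $2\le i\le n-1$ with label $n-i$. * $E_6/D_5$: the rows have the labels $1\,3\,4\,5\,6$; $2\,4\,5$; $3\,4\,2$; $1\,3\,4\,5\,6$, and begin in the columns $1,3,4,4$. * $E_7/E_6$: the rows have the labels $7\,6\,5\,4\,3\,1$; $2\,4\,3$; $5\,4\,2$; $6\,5\,4\,3\,1$; $7\,6\,5\,4\,3$; $2\,4$; $5$; $6$; $7$, and begin in the columns $1,4,5,5,5,8,9,9,9$. A subdiagram is a subset $\Lambda$ of the boxes such that, if $b\in\Lambda$, then every box of the diagram weakly above and weakly to the left of $b$ is in $\Lambda$. For a subdiagram $\Lambda$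 with rows $1,\dots,k$ let $r_i$ be the product of the simple reflections labelling the boxes of $\Lambda$ in row $i$, from left to right, and put $w_\Lambda=r_k^{-1}\cdots r_2^{-1}r_1^{-1}$. Then $\Lambda\mapsto w_\Lambda$ is a bijection from the set of subdiagrams onto $W^J$ (the subdiagram $\Lambda$ with $w_\Lambda=w$ is called the diagram of $w$), and it is an isomorphism of posets from the subdiagrams ordered by containment onto $W^J$ with the left weak order. Moreover, for $u,v\in W^J$, one has $u\le v$ in the Bruhat order if and only if the diagram of $u$ is contained in the diagram of $v$. -/

import Mathlib

open Finset

/-- The Coxeter matrix of type `D_n`, `n ≥ 3`, in the Bourbaki ordering of the nodes (the node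
`s_k` is `k - 1 : Fin n`): the chain `s_1 - s_2 - ⋯ - s_{n-1}`, and `s_n` joined to `s_{n-2}` only.
(Mathlib's `CoxeterMatrix.D` also joins the last two nodes, so it is not used here.) -/
def coxeterMatrixD (n : ℕ) : CoxeterMatrix (Fin n) where
  M := Matrix.of fun i j : Fin n ↦
    if i = j then 1
    else if ((i : ℕ) + 1 = j ∧ (j : ℕ) + 1 < n) ∨ ((j : ℕ) + 1 = i ∧ (i : ℕ) + 1 < n) ∨
        ((i : ℕ) + 2 = j ∧ (j : ℕ) + 1 = n) ∨ ((j : ℕ) + 2 = i ∧ (i : ℕ) + 1 = n) then 3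
    else 2
  isSymm := by
    ext i j
    simp only [Matrix.transpose_apply, Matrix.of_apply]
    split_ifs <;> first | rfl | (exfalso; grind)
  diagonal := by simp
  off_diagonal := by
    intro i j h
    simp only [Matrix.of_apply]
    rw [if_neg h]
    split_ifs <;> simp

/-- The Hermitian symmetric pairs `W / W_J`. -/
inductive HermitianPair : Type
  /-- `A_n / (A_{p-1} × A_{n-p})`. -/
  | A (n p : ℕ) (hp : 1 ≤ p) (hpn : p ≤ n) : HermitianPair
  /-- `C_n / A_{n-1}`. -/
  | C (n : ℕ) (hn : 2 ≤ n) : HermitianPair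
  /-- `B_n / B_{n-1}`. -/
  | B (n : ℕ) (hn : 2 ≤ n) : HermitianPair
  /-- `D_n / A_{n-1}`. -/
  | DA (n : ℕ) (hn : 3 ≤ n) : HermitianPair
  /-- `D_n / D_{n-1}`. -/
  | DD (n : ℕ) (hn : 3 ≤ n) : HermitianPair
  /-- `E_6 / D_5`. -/
  | E6 : HermitianPair
  /-- `E_7 / E_6`. -/
  | E7 : HermitianPair

namespace HermitianPair

/-- The number of simple reflections of `W`. -/
def rank : HermitianPair → ℕ
  | A n _ _ _ => n
  | C n _ => n
  | B n _ => n
  | DA n _ => n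
  | DD n _ => n
  | E6 => 6
  | E7 => 7

theorem rank_pos (T : HermitianPair) : 0 < T.rank := by
  cases T <;> simp only [rank] <;> omega

/-- The Coxeter matrix of `W`; its nodes are in the Bourbaki ordering, shifted by one. -/
def coxeterMatrix : (T : HermitianPair) → CoxeterMatrix (Fin T.rank)
  | A n _ _ _ => CoxeterMatrix.A n
  | C n _ => CoxeterMatrix.B n
  | B n _ => CoxeterMatrix.B n
  | DA n _ => coxeterMatrixD n
  | DD n _ => coxeterMatrixD n
  | E6 => CoxeterMatrix.E₆
  | E7 => CoxeterMatrix.E₇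

/-- The node with Bourbaki number `k`, where `1 ≤ k ≤ T.rank` (other values of `k` are not used). -/
def node (T : HermitianPair) (k : ℕ) : Fin T.rank :=
  ⟨(k - 1) % T.rank, Nat.mod_lt _ T.rank_pos⟩

/-- The Bourbaki number of the only simple reflection of `W` that is not in `J`. -/
def omitted : HermitianPair → ℕ
  | A _ p _ _ => p
  | C n _ => n
  | B _ _ => 1
  | DA n _ => n
  | DD _ _ => 1
  | E6 => 1
  | E7 => 7

/-- The subset `J` of the simple reflections. -/
def J (T : HermitianPair) : Set (Fin T.rank) := {i | i ≠ T.node T.omitted}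

/-- The boxes of the diagram of Hermitian type of the pair, as in a matrix: `(i, j)` is in row `i`
(counted from the top) and column `j` (counted from the left), both counted from `1`. -/
def boxes : HermitianPair → Finset (ℕ × ℕ)
  | A n p _ _ => Icc 1 (n + 1 - p) ×ˢ Icc 1 p
  | C n _ => {b ∈ Icc 1 n ×ˢ Icc 1 n | b.1 ≤ b.2}
  | B n _ => {1} ×ˢ Icc 1 n ∪ Icc 2 n ×ˢ {n}
  | DA n _ => {b ∈ Icc 1 (n - 1) ×ˢ Icc 1 (n - 1) | b.1 ≤ b.2}
  | DD n _ => {1} ×ˢ Icc 1 (n - 1) ∪ {2} ×ˢ Icc (n - 2) (n - 1) ∪ Icc 3 (n - 1) ×ˢ {n - 1}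
  | E6 => {1} ×ˢ Icc 1 5 ∪ {2} ×ˢ Icc 3 5 ∪ {3} ×ˢ Icc 4 6 ∪ {4} ×ˢ Icc 4 8
  | E7 => {1} ×ˢ Icc 1 6 ∪ {2} ×ˢ Icc 4 6 ∪ {3} ×ˢ Icc 5 7 ∪ {4} ×ˢ Icc 5 9 ∪ {5} ×ˢ Icc 5 9 ∪
      {6} ×ˢ Icc 8 9 ∪ Icc 7 9 ×ˢ {9}

/-- The label of a box of the diagram of Hermitian type (the values outside of `T.boxes` are not
used): the Bourbaki number of a simple reflection. -/
def label : HermitianPair → ℕ × ℕ → ℕ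
  | A _ p _ _, (i, j) => p + i - j
  | C n _, (i, j) => n + i - j
  | B n _, (i, j) => if i = 1 then j else n + 1 - i
  | DA n _, (i, j) => if i = j then (if Odd i then n else n - 1) else n - 1 + i - j
  | DD n _, (i, j) =>
      if i = 1 then (if j = n - 1 then n else j)
      else if i = 2 ∧ j = n - 2 then n - 1
      else n - i
  | E6, (i, j) => match i with
      | 1 => [1, 3, 4, 5, 6].getD (j - 1) 0
      | 2 => [2, 4, 5].getD (j - 3) 0
      | 3 => [3, 4, 2].getD (j - 4) 0
      | _ => [1, 3, 4, 5, 6].getD (j - 4) 0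
  | E7, (i, j) => match i with
      | 1 => [7, 6, 5, 4, 3, 1].getD (j - 1) 0
      | 2 => [2, 4, 3].getD (j - 4) 0
      | 3 => [5, 4, 2].getD (j - 5) 0
      | 4 => [6, 5, 4, 3, 1].getD (j - 5) 0
      | 5 => [7, 6, 5, 4, 3].getD (j - 5) 0
      | 6 => [2, 4].getD (j - 8) 0
      | 7 => 5
      | 8 => 6
      | _ => 7

theorem label_mem (T : HermitianPair) : ∀ b ∈ T.boxes, 1 ≤ T.label b ∧ T.label b ≤ T.rank := by
  cases T with
  | E6 => decide
  | E7 => decide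
  | _ =>
    rintro ⟨i, j⟩ h
    simp only [boxes, mem_filter, mem_union, mem_product, mem_Icc, mem_singleton] at h
    simp only [label, rank]
    try split_ifs
    all_goals omega

/-- A subdiagram: a set of boxes of the diagram that contains, with a box `b`, every box of the
diagram above and to the left of `b` (`c ≤ b` is the componentwise order). -/
def IsSubdiagram (T : HermitianPair) (L : Finset (ℕ × ℕ)) : Prop :=
  L ⊆ T.boxes ∧ ∀ b ∈ L, ∀ c ∈ T.boxes, c ≤ b → c ∈ L

/-- The subdiagrams, ordered by containment. -/
abbrev Subdiagram (T : HermitianPair) : Type := {L : Finset (ℕ × ℕ) // T.IsSubdiagram L}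

/-- The labels of the boxes of `L`, read row by row from the top to the bottom, each row from the
left to the right. -/
def rowWord (T : HermitianPair) (L : Finset (ℕ × ℕ)) : List (Fin T.rank) :=
  ((L.map toLex.toEmbedding).sort).map fun b ↦ T.node (T.label (ofLex b))

/-- The element `r_k⁻¹ ⋯ r_2⁻¹ r_1⁻¹` of `W` with the diagram `L`, where `r_i` is the product of the
simple reflections in the `i`-th row of `L`, from the left to the right. -/
def elementOf (T : HermitianPair) {W : Type*} [Group W] (cs : CoxeterSystem T.coxeterMatrix W)
    (L : Finset (ℕ × ℕ)) : W :=
  cs.wordProd (T.rowWord L).reverse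

end HermitianPair

namespace CoxeterSystem

variable {B : Type*} {M : CoxeterMatrix B} {W : Type*} [Group W] (cs : CoxeterSystem M W)

/-- `W^J`, the set of the minimal length representatives of the cosets `w W_J`. -/
def minimalReps (J : Set B) : Set W := {w | ∀ i ∈ J, cs.length w < cs.length (w * cs.simple i)}

/-- The left weak order of `W`. -/
def LeftWeakLE : W → W → Prop :=
  Relation.ReflTransGen fun u v ↦ cs.length u < cs.length v ∧ ∃ i, cs.simple i * u = v

/-- The (strong) Bruhat order of `W`. -/
def BruhatLE : W → W → Prop :=
  Relation.ReflTransGen fun u v ↦ cs.length u < cs.length v ∧ ∃ t, cs.IsReflection t ∧ t * u = v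

end CoxeterSystem

/-! The boxes, with their labels, form the heap of a minuscule representation, and `W^J` is the
orbit of its highest weight. An order ideal `L` carries a weight: `+1` at the label of a box that
can be added, `-1` at the label of a box that can be removed, `0` elsewhere. By `wt_insert`, adding
a box with label `i` subtracts the simple root `i`, so a simple reflection acts on ideals by adding
a box, removing a box or doing nothing. The state of an ideal also records its content, the number
of boxes with each label. Boxes with equal labels form a chain, so the content determines the ideal
(`state_injective`), and ideals can be compared through the action of `W`.

The element read from `L` moves the state of the empty ideal to the state of `L`. One letter changes
the number of boxes by at most one, so the reading word is reduced. By `elem_stay`, if `s_i` fixes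
the weight of `L`, then `s_i w_L = w_L s_j` with `s_j` in `J`. Hence every element of `W` is some
`w_L` times an element of `W_J`, and the `w_L` are exactly the minimal representatives.

Containment gives left weak order by adding boxes one at a time, and weak order implies Bruhat
order. For the way back, strong exchange turns a Bruhat step into the deletion of a letter, and a
subword of the reading word of `L` only reaches ideals inside `L` (`subset_of_sublist`). It remains
to check the heap conditions for each pair (`isHeap`). -/

namespace CoxeterSystem

/-! ### Strong exchange through a parity action on reflections -/

open List

variable {B : Type*} {M : CoxeterMatrix B} {W : Type*} [Group W] (cs : CoxeterSystem M W)

open Classical in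
/-- The action of a simple reflection on pairs of an element of `W` and a parity: conjugation on
the first component, and the parity changes at the simple reflection itself. -/
noncomputable def parityStep (i : B) : Function.End (W × ZMod 2) := fun p ↦
  (cs.simple i * p.1 * cs.simple i, p.2 + if p.1 = cs.simple i then 1 else 0)

-- A letter flips the parity exactly when `t`, conjugated by the letters to its right, has become
-- that simple reflection; these are the occurrences of `t` in the right inversion sequence.
open Classical in
theorem prod_map_parityStep (ω : List B) (t : W) (ε : ZMod 2) :
    (ω.map cs.parityStep).prod (t, ε) =
      (cs.wordProd ω * t * (cs.wordProd ω)⁻¹, ε + ((cs.rightInvSeq ω).count t : ZMod 2)) := by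
  induction ω with
  | nil => simp; rfl
  | cons i ω ih =>
    have h : (((i :: ω).map cs.parityStep).prod) (t, ε) =
        cs.parityStep i ((ω.map cs.parityStep).prod (t, ε)) := by
      simp only [List.map_cons, List.prod_cons]; rfl
    rw [h, ih, parityStep]
    simp only [rightInvSeq, List.count_cons, wordProd_cons, mul_inv_rev, inv_simple, Prod.mk.injEq]
    refine ⟨by group, ?_⟩
    have e : (cs.wordProd ω * t * (cs.wordProd ω)⁻¹ = cs.simple i) ↔
        ((cs.wordProd ω)⁻¹ * cs.simple i * cs.wordProd ω == t) = true := by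
      rw [beq_iff_eq]
      constructor
      · intro h; rw [← h]; group
      · intro h; rw [← h]; group
    simp only [e]
    split_ifs <;> push_cast <;> ring

-- Entry `k` of the sequence is an alternating product of length `2k + 1`. It depends on `k` only
-- modulo `m`, since `(s_j s_i)^m = 1`, so the second half of the sequence repeats the first.
open Classical in
theorem even_count_leftInvSeq_alternatingWord (i j : B) (t : W) :
    Even ((cs.leftInvSeq (alternatingWord i j (2 * M i j))).count t) := by
  set m := M i j with hm
  set l := cs.leftInvSeq (alternatingWord i j (2 * m)) with hl
  have hlen : l.length = 2 * m := by simp [hl]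
  have hper : l.drop m = l.take m := by
    apply List.ext_getElem
    · simp [hlen]; omega
    · intro k h1 h2
      have hk : k < m := by simp [hlen] at h2; omega
      rw [List.getElem_drop, List.getElem_take]
      simp only [hl]
      rw [getElem_leftInvSeq_alternatingWord cs i j m (m + k) (by omega),
        getElem_leftInvSeq_alternatingWord cs i j m k (by omega)]
      rw [prod_alternatingWord_eq_mul_pow, prod_alternatingWord_eq_mul_pow]
      have e1 : ¬ Even (2 * (m + k) + 1) := by simp
      have e2 : ¬ Even (2 * k + 1) := by simp
      rw [if_neg e1, if_neg e2]
      have e3 : (2 * (m + k) + 1) / 2 = m + k := by omega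
      have e4 : (2 * k + 1) / 2 = k := by omega
      rw [e3, e4, pow_add]
      have : (cs.simple j * cs.simple i) ^ m = 1 := by
        rw [hm, M.symmetric i j]; exact cs.simple_mul_simple_pow j i
      simp [this]
  rw [← List.take_append_drop m l, hper, List.count_append]
  exact ⟨_, rfl⟩

theorem isLiftable_parityStep : M.IsLiftable cs.parityStep := by
  classical
  intro i j
  have h (m : ℕ) : (cs.parityStep i * cs.parityStep j) ^ m =
      ((alternatingWord j i (2 * m)).reverse.map cs.parityStep).prod := by
    induction m with
    | zero => simp [alternatingWord]
    | succ m ih =>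
      rw [Nat.mul_succ, alternatingWord_succ, alternatingWord_succ]
      simp [pow_succ', ih, mul_assoc]
  rw [h]
  funext p
  obtain ⟨t, ε⟩ := p
  rw [prod_map_parityStep]
  have hw : cs.wordProd (alternatingWord j i (2 * M i j)).reverse = 1 := by
    rw [wordProd_reverse, prod_alternatingWord_eq_mul_pow]
    simp [M.symmetric i j]
  have hc : (((cs.rightInvSeq (alternatingWord j i (2 * M i j)).reverse).count t : ℕ) : ZMod 2)
      = 0 := by
    rw [ZMod.natCast_eq_zero_iff_even, rightInvSeq_reverse, List.count_reverse, M.symmetric i j]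
    exact cs.even_count_leftInvSeq_alternatingWord j i t
  rw [hw, hc]
  simp; rfl

/-- The action of `W` on pairs of an element of `W` and a parity. -/
noncomputable def parityRep : W →* Function.End (W × ZMod 2) :=
  cs.lift ⟨cs.parityStep, cs.isLiftable_parityStep⟩

open Classical in
theorem parityRep_wordProd (ω : List B) (t : W) (ε : ZMod 2) :
    cs.parityRep (cs.wordProd ω) (t, ε) =
      (cs.wordProd ω * t * (cs.wordProd ω)⁻¹, ε + ((cs.rightInvSeq ω).count t : ZMod 2)) := by
  have h : ⇑cs.parityRep ∘ cs.simple = cs.parityStep :=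
    funext fun i ↦ cs.lift_apply_simple cs.isLiftable_parityStep i
  rw [← prod_map_parityStep, wordProd, map_list_prod, List.map_map, h]

theorem parityRep_apply (w t : W) (ε : ZMod 2) :
    cs.parityRep w (t, ε) = (w * t * w⁻¹, ε + (cs.parityRep w (t, 0)).2) := by
  classical
  obtain ⟨ω, rfl⟩ := cs.wordProd_surjective w
  simp [parityRep_wordProd]

theorem parityRep_mul_snd (u w t : W) :
    (cs.parityRep (u * w) (t, 0)).2 =
      (cs.parityRep w (t, 0)).2 + (cs.parityRep u (w * t * w⁻¹, 0)).2 := by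
  have h : cs.parityRep (u * w) (t, 0) = cs.parityRep u (cs.parityRep w (t, 0)) := by
    rw [map_mul]; rfl
  rw [h, parityRep_apply cs w, parityRep_apply cs u]

/-- For `t = x s x⁻¹` the parities contributed by `x` and `x⁻¹` cancel modulo two, because `x⁻¹ x =
1`; the middle letter `s` contributes the remaining one. -/
theorem IsReflection.parityRep_self {t : W} (ht : cs.IsReflection t) :
    (cs.parityRep t (t, 0)).2 = 1 := by
  obtain ⟨x, i, rfl⟩ := ht
  have h1 : (cs.parityRep (cs.simple i) (cs.simple i, 0)).2 = 1 := by
    have : cs.parityRep (cs.simple i) = cs.parityStep i :=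
      cs.lift_apply_simple cs.isLiftable_parityStep i
    rw [this]; simp [parityStep]
  have h2 : (cs.parityRep (x⁻¹ * x) (cs.simple i, 0)).2 = 0 := by
    rw [inv_mul_cancel, map_one]; rfl
  rw [parityRep_mul_snd] at h2
  rw [parityRep_mul_snd, parityRep_mul_snd]
  have e1 : x⁻¹ * (x * cs.simple i * x⁻¹) * x⁻¹⁻¹ = cs.simple i := by group
  have e2 : cs.simple i * cs.simple i * (cs.simple i)⁻¹ = cs.simple i := by group
  rw [e1, e2, h1]
  linear_combination h2

/-- The strong exchange property. -/
theorem IsRightInversion.mem_rightInvSeq {ω : List B} {t : W}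
    (h : cs.IsRightInversion (cs.wordProd ω) t) : t ∈ cs.rightInvSeq ω := by
  classical
  obtain ⟨ht, hlt⟩ := h
  by_contra hmem
  obtain ⟨ω', hred, hω'⟩ := cs.exists_isReduced (cs.wordProd ω * t)
  -- The parity of `t` depends only on the group element. If it is even for `w`, it is odd for `w
  -- t`; then `t` is an inversion of `w t`, so `w` is shorter than `w t`, a contradiction.
  have h0 : (cs.parityRep (cs.wordProd ω) (t, 0)).2 = 0 := by
    rw [parityRep_wordProd, List.count_eq_zero_of_not_mem hmem]; simp
  have h1 : (cs.parityRep (cs.wordProd ω * t) (t, 0)).2 = 1 := by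
    rw [parityRep_mul_snd, ht.parityRep_self]
    have : t * t * t⁻¹ = t := by group
    rw [this, h0, add_zero]
  have h2 : t ∈ cs.rightInvSeq ω' := by
    by_contra hm
    rw [hω', parityRep_wordProd, List.count_eq_zero_of_not_mem hm] at h1
    simp at h1
  have h3 := (cs.isRightInversion_of_mem_rightInvSeq hred h2).2
  rw [← hω', mul_assoc, ht.mul_self, mul_one] at h3
  omega

theorem IsLeftInversion.exists_sublist {ω : List B} {t : W}
    (h : cs.IsLeftInversion (cs.wordProd ω) t) :
    ∃ ω', ω'.Sublist ω ∧ t * cs.wordProd ω = cs.wordProd ω' := by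
  rw [← isRightInversion_inv_iff, ← wordProd_reverse] at h
  have hm := h.mem_rightInvSeq
  rw [rightInvSeq_reverse, List.mem_reverse] at hm
  obtain ⟨j, hj, rfl⟩ := List.mem_iff_getElem.mp hm
  refine ⟨ω.eraseIdx j, List.eraseIdx_sublist _ _, ?_⟩
  rw [← getD_leftInvSeq_mul_wordProd, List.getD_eq_getElem _ _ hj]

end CoxeterSystem

/-! ### Minuscule heaps, order ideals and their weights -/

/-- A finite poset `P` of boxes, labelled by the nodes of a Coxeter diagram, is a *minuscule heap*
with respect to the Cartan matrix `A` and the node `o` of its smallest box. The last three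
conditions say that two consecutive boxes with the label `i` are separated by boxes with labels
adjacent to `i` of total weight two. -/
structure IsMinusculeHeap {B α : Type*} [PartialOrder α] (M : CoxeterMatrix B) (A : B → B → ℤ)
    (P : Finset α) (lab : α → B) (o : B) : Prop where
  diag : ∀ i, A i i = 2
  off_diag : ∀ i j, i ≠ j → (M i j = 2 ∧ A i j = 0 ∧ A j i = 0) ∨
    (M i j = 3 ∧ A i j = -1 ∧ A j i = -1) ∨
    (M i j = 4 ∧ (A i j = -1 ∧ A j i = -2 ∨ A i j = -2 ∧ A j i = -1))
  bot : ∃ b ∈ P, lab b = o ∧ ∀ c ∈ P, b ≤ c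
  between : ∀ c ∈ P, ∀ b ∈ P, c < b → 0 ≤ A (lab c) (lab b) → ∃ e ∈ P, c < e ∧ e < b
  comparable : ∀ c ∈ P, ∀ b ∈ P, A (lab c) (lab b) ≠ 0 → c ≤ b ∨ b ≤ c
  other : ∀ c ∈ P, ∀ b ∈ P, ∀ d ∈ P, c < b → b < d → lab c = lab d →
    A (lab c) (lab b) = -1 → ∃ e ∈ P, e ≠ b ∧ c < e ∧ e < d
  double : ∀ i, ∀ b ∈ P, A i (lab b) = -2 →
    (∃ c ∈ P, lab c = i ∧ c < b ∧ ∀ e ∈ P, c < e → b ≤ e) ∧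
    (∃ d ∈ P, lab d = i ∧ b < d ∧ ∀ e ∈ P, e < d → e ≤ b)
  single : ∀ i, ∀ b ∈ P, A i (lab b) = -1 →
    (∃ c ∈ P, lab c = i ∧ c < b ∧ ∀ e ∈ P, c < e → b ≤ e) ∨
    (∃ d ∈ P, lab d = i ∧ b < d ∧ ∀ e ∈ P, e < d → e ≤ b) ∨
    (∃ c ∈ P, lab c = i ∧ c < b ∧ ∃ d ∈ P, lab d = i ∧ b < d ∧
      ∀ e ∈ P, e < d → ∀ f ∈ P, c < f → e ≤ b ∨ b ≤ f ∨ e ≤ f)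

namespace IsMinusculeHeap

section Poset

variable {α : Type*} [PartialOrder α]

/-- Order ideals of the poset `P`. -/
def IsIdeal (P L : Finset α) : Prop := L ⊆ P ∧ ∀ b ∈ L, ∀ c ∈ P, c ≤ b → c ∈ L

/-- The box `b` can be added to the ideal `L`. -/
def Addable (P L : Finset α) (b : α) : Prop := b ∈ P ∧ b ∉ L ∧ ∀ c ∈ P, c < b → c ∈ L

/-- The box `b` can be removed from the ideal `L`. -/
def Removable (L : Finset α) (b : α) : Prop := b ∈ L ∧ ∀ c ∈ L, ¬ b < c

variable {P L : Finset α} {b : α}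

theorem isIdeal_empty : IsIdeal P ∅ := by simp [IsIdeal]

variable [DecidableEq α]

theorem IsIdeal.insert (hL : IsIdeal P L) (hb : Addable P L b) : IsIdeal P (insert b L) := by
  refine ⟨Finset.insert_subset hb.1 hL.1, fun c hc d hd hdc ↦ ?_⟩
  rw [Finset.mem_insert] at hc ⊢
  rcases hc with rfl | hc
  · rcases hdc.eq_or_lt with h | h
    · exact .inl h
    · exact .inr (hb.2.2 d hd h)
  · exact .inr (hL.2 c hc d hd hdc)

theorem Addable.removable (hL : IsIdeal P L) (hb : Addable P L b) : Removable (insert b L) b := by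
  refine ⟨Finset.mem_insert_self _ _, fun c hc hbc ↦ ?_⟩
  rcases Finset.mem_insert.1 hc with rfl | hc
  · exact lt_irrefl _ hbc
  · exact hb.2.1 (hL.2 c hc b hb.1 hbc.le)

theorem IsIdeal.erase (hL : IsIdeal P L) (hb : Removable L b) : IsIdeal P (L.erase b) := by
  refine ⟨(Finset.erase_subset _ _).trans hL.1, fun c hc d hd hdc ↦ ?_⟩
  rw [Finset.mem_erase] at hc ⊢
  refine ⟨?_, hL.2 c hc.2 d hd hdc⟩
  rintro rfl
  exact hb.2 c hc.2 (lt_of_le_of_ne hdc hc.1.symm)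

theorem Removable.addable (hL : IsIdeal P L) (hb : Removable L b) : Addable P (L.erase b) b :=
  ⟨hL.1 hb.1, Finset.notMem_erase _ _, fun c hc hcb ↦
    Finset.mem_erase.2 ⟨hcb.ne, hL.2 b hb.1 c hc hcb.le⟩⟩

end Poset

section Weight

variable {B α : Type*} [PartialOrder α] (P : Finset α) (lab : α → B)

open Classical in
/-- The weight of an ideal, in the basis of the fundamental weights. -/
noncomputable def wt (L : Finset α) (i : B) : ℤ :=
  (if ∃ b, Addable P L b ∧ lab b = i then 1 else 0) -
    if ∃ b, Removable L b ∧ lab b = i then 1 else 0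

open Classical in
/-- The number of boxes with each label. -/
noncomputable def content (L : Finset α) (i : B) : ℤ := #{b ∈ L | lab b = i}

/-- The content and the weight of an ideal. -/
noncomputable def state (L : Finset α) : (B → ℤ) × (B → ℤ) := (content lab L, wt P lab L)

open Classical in
/-- The action of a simple reflection on contents and weights. -/
noncomputable def step (A : B → B → ℤ) (i : B) : Function.End ((B → ℤ) × (B → ℤ)) := fun p ↦
  (fun k ↦ p.1 k + if k = i then p.2 i else 0, fun k ↦ p.2 k - p.2 i * A k i)

end Weight

variable {B α : Type*} [PartialOrder α] {M : CoxeterMatrix B} {A : B → B → ℤ}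
  {P : Finset α} {lab : α → B} {o : B} (h : IsMinusculeHeap M A P lab o)
include h

theorem zero_symm {i j : B} (hij : A i j = 0) : A j i = 0 := by
  by_cases e : i = j
  · subst e; exact hij
  · rcases h.off_diag i j e with h | h | h <;> omega

section Ideals

variable {L : Finset α}

/-- Boxes with equal labels are comparable and have another box strictly between them. Hence the two
terms of `wt` never cancel. -/
theorem no_both (hL : IsIdeal P L) {c d : α} (hc : Removable L c) (hd : Addable P L d) :
    lab c ≠ lab d := by
  intro e
  have hcP := hL.1 hc.1
  rcases h.comparable c hcP d hd.1 (by rw [e, h.diag]; omega) with hcd | hcd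
  · have hlt : c < d := lt_of_le_of_ne hcd (by rintro rfl; exact hd.2.1 hc.1)
    obtain ⟨f, hf, h1, h2⟩ := h.between c hcP d hd.1 hlt (by rw [e, h.diag]; omega)
    exact hc.2 f (hd.2.2 f hf h2) h1
  · exact hd.2.1 (hL.2 c hc.1 d hd.1 hcd)

theorem wt_addable (hL : IsIdeal P L) {b : α} (hb : Addable P L b) : wt P lab L (lab b) = 1 := by
  rw [wt, if_pos ⟨b, hb, rfl⟩, if_neg]
  · rfl
  · rintro ⟨c, hc, e⟩
    exact h.no_both hL hc hb e

theorem wt_removable (hL : IsIdeal P L) {b : α} (hb : Removable L b) :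
    wt P lab L (lab b) = -1 := by
  rw [wt, if_neg, if_pos ⟨b, hb, rfl⟩]
  · rfl
  · rintro ⟨c, hc, e⟩
    exact h.no_both hL hb hc e.symm

omit h in
theorem wt_cases (i : B) : wt P lab L i = 0 ∨ (∃ b, Addable P L b ∧ lab b = i) ∨
    ∃ b, Removable L b ∧ lab b = i := by
  by_cases h1 : ∃ b, Addable P L b ∧ lab b = i
  · exact .inr (.inl h1)
  by_cases h2 : ∃ b, Removable L b ∧ lab b = i
  · exact .inr (.inr h2)
  left
  rw [wt, if_neg h1, if_neg h2]; rfl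

theorem wt_empty {i : B} (hi : i ≠ o) : wt P lab ∅ i = 0 := by
  obtain ⟨b, hb, hbo, hmin⟩ := h.bot
  rcases wt_cases (P := P) (lab := lab) (L := ∅) i with h0 | ⟨c, hc, e⟩ | ⟨c, hc, e⟩
  · exact h0
  · exfalso
    rcases (hmin c hc.1).eq_or_lt with e' | hlt
    · exact hi (by rw [← e, ← e', hbo])
    · exact absurd (hc.2.2 b hb hlt) (Finset.notMem_empty _)
  · exact absurd hc.1 (Finset.notMem_empty _)

theorem wt_empty_self : wt P lab ∅ o = 1 := by
  obtain ⟨b, hb, hbo, hmin⟩ := h.bot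
  rw [← hbo]
  exact h.wt_addable isIdeal_empty ⟨hb, by simp, fun c hc hcb ↦ absurd (hmin c hc) hcb.not_ge⟩

variable [DecidableEq α]

/-- At the label of `b` the weight drops from `1` to `-1`. For a label orthogonal to it, `between`
keeps `b` from affecting which boxes can be added or removed. For an adjacent label `j`, adding `b`
blocks the removable `j`-boxes below it and may free a `j`-box above it: `double` makes both happen
when the entry is `-2`, while `single` and `other` make exactly one happen when it is `-1`. -/
theorem wt_insert (hL : IsIdeal P L) {b : α} (hb : Addable P L b) (j : B) :
    wt P lab (insert b L) j = wt P lab L j - A j (lab b) := by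
  have hL' := hL.insert hb
  by_cases hj : j = lab b
  · subst hj
    rw [h.wt_removable hL' (hb.removable hL), h.wt_addable hL hb, h.diag]; rfl
  by_cases h0 : A j (lab b) = 0
  · have hadd : (∃ d, Addable P (insert b L) d ∧ lab d = j) ↔ ∃ d, Addable P L d ∧ lab d = j := by
      constructor
      · rintro ⟨d, hd, rfl⟩
        refine ⟨d, ⟨hd.1, fun hm ↦ hd.2.1 (Finset.mem_insert_of_mem hm), fun c hc hcd ↦ ?_⟩, rfl⟩
        rcases Finset.mem_insert.1 (hd.2.2 c hc hcd) with rfl | hm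
        · obtain ⟨e, he, h1, h2⟩ := h.between c hc d hd.1 hcd (h.zero_symm h0).ge
          rcases Finset.mem_insert.1 (hd.2.2 e he h2) with rfl | hm
          · exact absurd h1 (lt_irrefl _)
          · exact hL.2 e hm c hc h1.le
        · exact hm
      · rintro ⟨d, hd, rfl⟩
        refine ⟨d, ⟨hd.1, fun hm ↦ ?_, fun c hc hcd ↦
          Finset.mem_insert_of_mem (hd.2.2 c hc hcd)⟩, rfl⟩
        rcases Finset.mem_insert.1 hm with rfl | hm
        · exact hj rfl
        · exact hd.2.1 hm
    have hrem : (∃ d, Removable (insert b L) d ∧ lab d = j) ↔ ∃ d, Removable L d ∧ lab d = j := by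
      constructor
      · rintro ⟨d, hd, rfl⟩
        have hdL : d ∈ L := by
          rcases Finset.mem_insert.1 hd.1 with rfl | hm
          · exact absurd rfl hj
          · exact hm
        exact ⟨d, ⟨hdL, fun c hc ↦ hd.2 c (Finset.mem_insert_of_mem hc)⟩, rfl⟩
      · rintro ⟨d, hd, rfl⟩
        refine ⟨d, ⟨Finset.mem_insert_of_mem hd.1, fun c hc hdc ↦ ?_⟩, rfl⟩
        rcases Finset.mem_insert.1 hc with rfl | hc
        · obtain ⟨e, he, h1, h2⟩ := h.between d (hL.1 hd.1) c hb.1 hdc h0.ge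
          exact hd.2 e (hb.2.2 e he h2) h1
        · exact hd.2 c hc hdc
    rw [h0, sub_zero, wt, wt]
    congr 1
    · classical exact if_congr hadd rfl rfl
    · classical exact if_congr hrem rfl rfl
  -- Every `j`-box is now comparable with `b`: so none is removable once `b` is present, and none
  -- was addable before.
  have hcomp : ∀ c ∈ P, lab c = j → c ≤ b ∨ b ≤ c := fun c hc e ↦
    h.comparable c hc b hb.1 (by rw [e]; exact h0)
  have hnr : ¬ ∃ d, Removable (insert b L) d ∧ lab d = j := by
    rintro ⟨d, hd, rfl⟩
    have hne : d ≠ b := by rintro rfl; exact hj rfl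
    have hdL : d ∈ L := (Finset.mem_insert.1 hd.1).resolve_left hne
    rcases hcomp d (hL.1 hdL) rfl with hle | hle
    · exact hd.2 b (Finset.mem_insert_self _ _) (lt_of_le_of_ne hle hne)
    · exact hb.2.1 (hL.2 d hdL b hb.1 hle)
  have hna : ¬ ∃ d, Addable P L d ∧ lab d = j := by
    rintro ⟨d, hd, rfl⟩
    have hne : d ≠ b := by rintro rfl; exact hj rfl
    rcases hcomp d hd.1 rfl with hle | hle
    · exact hd.2.1 (hb.2.2 d hd.1 (lt_of_le_of_ne hle hne))
    · exact hb.2.1 (hd.2.2 b hb.1 (lt_of_le_of_ne hle hne.symm))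
  have hrem_of {c : α} (hc : c ∈ P) (hcb : c < b) (hce : ∀ e ∈ P, c < e → b ≤ e) :
      Removable L c :=
    ⟨hb.2.2 c hc hcb, fun e he hlt ↦ hb.2.1 (hL.2 e he b hb.1 (hce e (hL.1 he) hlt))⟩
  have hnot {d : α} (hd : b < d) : d ∉ insert b L := fun hm ↦
    (hb.removable hL).2 d hm hd
  have hadd_of {d : α} (hd : d ∈ P) (hbd : b < d) (hde : ∀ e ∈ P, e < d → e ≤ b) :
      Addable P (insert b L) d :=
    ⟨hd, hnot hbd, fun e he hlt ↦ hL'.2 b (Finset.mem_insert_self _ _) e he (hde e he hlt)⟩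
  rw [wt, wt, if_neg hnr, if_neg hna]
  have hcase : A j (lab b) = -1 ∨ A j (lab b) = -2 := by
    rcases h.off_diag j (lab b) hj with h | h | h <;> omega
  rcases hcase with h1 | h2
  · have hone : (∃ d, Addable P (insert b L) d ∧ lab d = j) ↔
        ¬ ∃ d, Removable L d ∧ lab d = j := by
      constructor
      · rintro ⟨d, hd, rfl⟩ ⟨c, hc, e⟩
        have hcP := hL.1 hc.1
        have hcb : c < b := by
          rcases hcomp c hcP e with hle | hle
          · exact lt_of_le_of_ne hle (by rintro rfl; exact hb.2.1 hc.1)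
          · exact absurd (hL.2 c hc.1 b hb.1 hle) hb.2.1
        have hbd : b < d := by
          have hne : d ≠ b := by rintro rfl; exact hj rfl
          rcases hcomp d hd.1 rfl with hle | hle
          · exact absurd (Finset.mem_insert_of_mem (hb.2.2 d hd.1 (lt_of_le_of_ne hle hne))) hd.2.1
          · exact lt_of_le_of_ne hle hne.symm
        obtain ⟨f, hf, hfb, hcf, hfd⟩ := h.other c hcP b hb.1 d hd.1 hcb hbd e (by rw [e, h1])
        exact hc.2 f ((Finset.mem_insert.1 (hd.2.2 f hf hfd)).resolve_left hfb) hcf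
      · intro hno
        rcases h.single j b hb.1 h1 with ⟨c, hc, e, hcb, hce⟩ | ⟨d, hd, e, hbd, hde⟩ |
          ⟨c, hc, e, hcb, d, hd, e', hbd, hcd⟩
        · exact absurd ⟨c, hrem_of hc hcb hce, e⟩ hno
        · exact ⟨d, hadd_of hd hbd hde, e⟩
        -- Since `c` is not removable, some `f` in `L` lies above `c`, and `f` is not above `b`.
        -- Every box below `d` is then below `b` or below `f`, which makes `d` addable.
        · have hnc : ¬ Removable L c := fun hr ↦ hno ⟨c, hr, e⟩
          have : ∃ f ∈ L, c < f := by
            by_contra hcon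
            push Not at hcon
            exact hnc ⟨hb.2.2 c hc hcb, hcon⟩
          obtain ⟨f, hf, hcf⟩ := this
          refine ⟨d, ⟨hd, hnot hbd, fun x hx hxd ↦ ?_⟩, e'⟩
          rcases hcd x hx hxd f (hL.1 hf) hcf with hle | hle | hle
          · exact hL'.2 b (Finset.mem_insert_self _ _) x hx hle
          · exact absurd (hL.2 f hf b hb.1 hle) hb.2.1
          · exact Finset.mem_insert_of_mem (hL.2 f hf x hx hle)
    rw [h1]
    by_cases hr : ∃ d, Removable L d ∧ lab d = j
    · rw [if_pos hr, if_neg (fun hh ↦ hone.1 hh hr)]; rfl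
    · rw [if_neg hr, if_pos (hone.2 hr)]; rfl
  · obtain ⟨⟨c, hc, e, hcb, hce⟩, d, hd, e', hbd, hde⟩ := h.double j b hb.1 h2
    rw [h2, if_pos ⟨d, hadd_of hd hbd hde, e'⟩, if_pos ⟨c, hrem_of hc hcb hce, e⟩]; rfl

end Ideals

end IsMinusculeHeap

/-! ### The action of `W` on contents and weights -/

namespace IsMinusculeHeap

section Content

variable {B α : Type*} [DecidableEq α] {L : Finset α} {lab : α → B}

theorem content_insert {b : α} (hb : b ∉ L) (k : B) [Decidable (k = lab b)] :
    content lab (insert b L) k = content lab L k + if k = lab b then 1 else 0 := by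
  classical
  rw [content, content, Finset.filter_insert]
  by_cases e : k = lab b
  · rw [if_pos e.symm, if_pos e, Finset.card_insert_of_notMem (by simp [hb])]
    push_cast; rfl
  · rw [if_neg (Ne.symm e), if_neg e, add_zero]

end Content

section Action

variable {B α : Type*} [PartialOrder α] {M : CoxeterMatrix B} {A : B → B → ℤ}
  {P : Finset α} {lab : α → B} {o : B} (h : IsMinusculeHeap M A P lab o)
include h

theorem step_mul_self (i : B) : step A i * step A i = 1 := by
  funext ⟨c, v⟩
  change step A i (step A i (c, v)) = (c, v)
  have hi := h.diag i
  simp only [step, Prod.mk.injEq]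
  constructor <;> funext k
  · by_cases hk : k = i
    · subst hk; simp [hi]; ring
    · simp [hk]
  · simp only [hi]; ring

/-- Only the rank two Cartan submatrix of `i, j` enters, so each Coxeter relation is a direct
computation, for `m = 2, 3, 4`. -/
theorem isLiftable_step : M.IsLiftable (step A) := by
  intro i j
  by_cases hij : i = j
  · subst hij
    rw [M.diagonal, pow_one, h.step_mul_self]
  have hi := h.diag i
  have hj := h.diag j
  have hji : j ≠ i := Ne.symm hij
  rcases h.off_diag i j hij with ⟨hm, h1, h2⟩ | ⟨hm, h1, h2⟩ | ⟨hm, ⟨h1, h2⟩ | ⟨h1, h2⟩⟩ <;> rw [hm]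
  · funext ⟨c, v⟩
    change step A i (step A j (step A i (step A j (c, v)))) = (c, v)
    simp only [step, Prod.mk.injEq, hi, hj, h1, h2]
    constructor <;> funext k
    · split_ifs <;> ring
    · ring
  · funext ⟨c, v⟩
    change step A i (step A j (step A i (step A j (step A i (step A j (c, v)))))) = (c, v)
    simp only [step, Prod.mk.injEq, hi, hj, h1, h2]
    constructor <;> funext k
    · split_ifs <;> ring
    · ring
  · funext ⟨c, v⟩
    change step A i (step A j (step A i (step A j (step A i (step A j (step A i (step A j
      (c, v)))))))) = (c, v)
    simp only [step, Prod.mk.injEq, hi, hj, h1, h2]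
    constructor <;> funext k
    · split_ifs <;> ring
    · ring
  · funext ⟨c, v⟩
    change step A i (step A j (step A i (step A j (step A i (step A j (step A i (step A j
      (c, v)))))))) = (c, v)
    simp only [step, Prod.mk.injEq, hi, hj, h1, h2]
    constructor <;> funext k
    · split_ifs <;> ring
    · ring

/-- The action of `W` on contents and weights. -/
noncomputable def rep {W : Type*} [Group W] (cs : CoxeterSystem M W) :
    W →* Function.End ((B → ℤ) × (B → ℤ)) := cs.lift ⟨step A, h.isLiftable_step⟩

/-- Boxes with a given label form a chain, and an ideal meets it in an initial segment, which is
determined by its size. -/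
theorem content_injective {L K : Finset α} (hL : IsIdeal P L) (hK : IsIdeal P K)
    (e : content lab L = content lab K) : L ⊆ K := by
  classical
  intro b hb
  by_contra hbK
  have hlt : {c ∈ K | lab c = lab b} ⊂ {c ∈ L | lab c = lab b} := by
    rw [Finset.ssubset_iff_of_subset]
    · exact ⟨b, by simp [hb], by simp [hbK]⟩
    · intro c hc
      rw [Finset.mem_filter] at hc ⊢
      refine ⟨?_, hc.2⟩
      rcases h.comparable c (hK.1 hc.1) b (hL.1 hb) (by rw [hc.2, h.diag]; omega) with hle | hle
      · exact hL.2 b hb c (hK.1 hc.1) hle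
      · exact absurd (hK.2 c hc.1 b (hL.1 hb) hle) hbK
  have hcard := Finset.card_lt_card hlt
  have := congrFun e (lab b)
  simp only [content] at this
  omega

theorem state_injective {L K : Finset α} (hL : IsIdeal P L) (hK : IsIdeal P K)
    (e : state P lab L = state P lab K) : L = K :=
  (h.content_injective hL hK (congrArg Prod.fst e)).antisymm
    (h.content_injective hK hL (congrArg Prod.fst e).symm)

section Step

variable [DecidableEq α] {L : Finset α}

theorem step_state_addable (hL : IsIdeal P L) {b : α} (hb : Addable P L b) :
    step A (lab b) (state P lab L) = state P lab (insert b L) := by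
  classical
  simp only [step, state, Prod.mk.injEq, h.wt_addable hL hb]
  constructor <;> funext k
  · rw [content_insert hb.2.1]
  · rw [h.wt_insert hL hb]; ring

theorem step_state_removable (hL : IsIdeal P L) {b : α} (hb : Removable L b) :
    step A (lab b) (state P lab L) = state P lab (L.erase b) := by
  have h1 := h.step_state_addable (hL.erase hb) (hb.addable hL)
  rw [Finset.insert_erase hb.1] at h1
  rw [← h1]
  exact congrFun (h.step_mul_self (lab b)) _

omit h [DecidableEq α] in
theorem step_state_zero {i : B} (hi : wt P lab L i = 0) :
    step A i (state P lab L) = state P lab L := by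
  simp [step, state, hi]

end Step

end Action

/-! ### Elements read from ideals: lengths, coset representatives and the two orders -/

/-- A function that assigns to each ideal the labels along a linear extension, from the top to the
bottom. -/
def IsReading {B α : Type*} [PartialOrder α] [DecidableEq α] (P : Finset α) (lab : α → B)
    (word : Finset α → List B) : Prop :=
  word ∅ = [] ∧ ∀ L, IsIdeal P L → L.Nonempty →
    ∃ m, Removable L m ∧ word L = lab m :: word (L.erase m)

section Elements

variable {B α : Type*} [PartialOrder α] [DecidableEq α] {M : CoxeterMatrix B} {A : B → B → ℤ}
  {P : Finset α} {lab : α → B} {o : B} (h : IsMinusculeHeap M A P lab o)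
  {W : Type*} [Group W] (cs : CoxeterSystem M W)
  {word : Finset α → List B} (hw : IsReading P lab word)

omit [PartialOrder α] [DecidableEq α] in
theorem braid_two {i j : B} (e : M i j = 2) :
    cs.simple i * cs.simple j = cs.simple j * cs.simple i := by
  have := cs.wordProd_braidWord_eq i j
  simpa [CoxeterSystem.braidWord, M.symmetric j i, e, CoxeterSystem.alternatingWord,
    CoxeterSystem.wordProd] using this

omit [PartialOrder α] [DecidableEq α] in
theorem braid_three {i j : B} (e : M i j = 3) :
    cs.simple i * (cs.simple j * cs.simple i) = cs.simple j * (cs.simple i * cs.simple j) := by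
  have := cs.wordProd_braidWord_eq i j
  simpa [CoxeterSystem.braidWord, M.symmetric j i, e, CoxeterSystem.alternatingWord,
    CoxeterSystem.wordProd] using this.symm

omit [PartialOrder α] [DecidableEq α] in
theorem braid_four {i j : B} (e : M i j = 4) :
    cs.simple i * (cs.simple j * (cs.simple i * cs.simple j)) =
      cs.simple j * (cs.simple i * (cs.simple j * cs.simple i)) := by
  have := cs.wordProd_braidWord_eq i j
  simpa [CoxeterSystem.braidWord, M.symmetric j i, e, CoxeterSystem.alternatingWord,
    CoxeterSystem.wordProd] using this

include h

omit [DecidableEq α] in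
theorem rep_simple_mul (i : B) (w : W) (x : (B → ℤ) × (B → ℤ)) :
    h.rep cs (cs.simple i * w) x = step A i (h.rep cs w x) := by
  rw [map_mul]
  have : h.rep cs (cs.simple i) = step A i := cs.lift_apply_simple h.isLiftable_step i
  rw [this]; rfl

omit [DecidableEq α] in
theorem rep_mul (u w : W) (x : (B → ℤ) × (B → ℤ)) :
    h.rep cs (u * w) x = h.rep cs u (h.rep cs w x) := by
  rw [map_mul]; rfl

omit [DecidableEq α] in
theorem rep_parabolic {ω : List B} (hω : ∀ i ∈ ω, i ≠ o) :
    h.rep cs (cs.wordProd ω) (state P lab ∅) = state P lab ∅ := by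
  induction ω with
  | nil => simp; rfl
  | cons i ω ih =>
    rw [cs.wordProd_cons, rep_simple_mul, ih fun j hj ↦ hω j (List.mem_cons_of_mem _ hj)]
    exact step_state_zero (h.wt_empty (hω i List.mem_cons_self))

/-- The bound on the number of boxes is what yields lower bounds for lengths, in `card_le_length`.
-/
theorem exists_rep_eq (ω : List B) : ∃ L, IsIdeal P L ∧ #L ≤ ω.length ∧
    h.rep cs (cs.wordProd ω) (state P lab ∅) = state P lab L := by
  induction ω with
  | nil => exact ⟨∅, isIdeal_empty, by simp, by simp; rfl⟩
  | cons i ω ih =>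
    obtain ⟨L, hL, hc, e⟩ := ih
    rw [cs.wordProd_cons, rep_simple_mul, e]
    rcases wt_cases (P := P) (lab := lab) (L := L) i with h0 | ⟨b, hb, rfl⟩ | ⟨b, hb, rfl⟩
    · exact ⟨L, hL, by simp; omega, step_state_zero h0⟩
    · exact ⟨_, hL.insert hb, by simp [Finset.card_insert_of_notMem hb.2.1, hc],
        h.step_state_addable hL hb⟩
    · exact ⟨_, hL.erase hb, by simp [Finset.card_erase_of_mem hb.1]; omega,
        h.step_state_removable hL hb⟩

include hw

theorem rep_word (L : Finset α) (hL : IsIdeal P L) :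
    h.rep cs (cs.wordProd (word L)) (state P lab ∅) = state P lab L := by
  induction hn : #L generalizing L with
  | zero => rw [Finset.card_eq_zero.1 hn, hw.1]; simp; rfl
  | succ n ih =>
    obtain ⟨m, hm, e⟩ := hw.2 L hL (Finset.card_pos.1 (by omega))
    rw [e, cs.wordProd_cons, rep_simple_mul,
      ih _ (hL.erase hm) (by rw [Finset.card_erase_of_mem hm.1]; omega),
      h.step_state_addable (hL.erase hm) (hm.addable hL), Finset.insert_erase hm.1]

omit h in
theorem length_word (L : Finset α) (hL : IsIdeal P L) : (word L).length = #L := by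
  induction hn : #L generalizing L with
  | zero => rw [Finset.card_eq_zero.1 hn, hw.1]; rfl
  | succ n ih =>
    obtain ⟨m, hm, e⟩ := hw.2 L hL (Finset.card_pos.1 (by omega))
    rw [e, List.length_cons,
      ih _ (hL.erase hm) (by rw [Finset.card_erase_of_mem hm.1]; omega)]

omit hw in
theorem card_le_length (w : W) (L : Finset α) (hL : IsIdeal P L)
    (e : h.rep cs w (state P lab ∅) = state P lab L) : #L ≤ cs.length w := by
  obtain ⟨ω, hred, rfl⟩ := cs.exists_isReduced w
  obtain ⟨K, hK, hc, e'⟩ := h.exists_rep_eq cs ω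
  rw [h.state_injective hL hK (e.symm.trans e'), hred.eq]
  exact hc

theorem length_elem (L : Finset α) (hL : IsIdeal P L) :
    cs.length (cs.wordProd (word L)) = #L := by
  refine le_antisymm ?_ (h.card_le_length cs _ L hL (h.rep_word cs hw L hL))
  rw [← length_word hw L hL]
  exact cs.length_wordProd_le _

/-- The element does not depend on the linear extension. If the word starts with a box `m` other
than `b`, both are maximal in the larger ideal, hence incomparable, so their labels commute and
induction applies after removing `m`. -/
theorem elem_insert (L : Finset α) (hL : IsIdeal P L) (b : α) (hb : Addable P L b) :
    cs.wordProd (word (insert b L)) = cs.simple (lab b) * cs.wordProd (word L) := by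
  induction hn : #L using Nat.strong_induction_on generalizing L b with
  | _ n ih =>
    have hK := hL.insert hb
    have hbr := hb.removable hL
    obtain ⟨m, hm, e⟩ := hw.2 _ hK (Finset.insert_nonempty b L)
    rw [e, cs.wordProd_cons]
    by_cases hmb : m = b
    · rw [hmb, Finset.erase_insert hb.2.1]
    have hmL : m ∈ L := (Finset.mem_insert.1 hm.1).resolve_left hmb
    have hmr : Removable L m := ⟨hmL, fun c hc ↦ hm.2 c (Finset.mem_insert_of_mem hc)⟩
    have hL1 := hL.erase hmr
    have hb1 : Addable P (L.erase m) b := by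
      refine ⟨hb.1, fun hc ↦ hb.2.1 (Finset.mem_of_mem_erase hc), fun c hc hcb ↦
        Finset.mem_erase.2 ⟨?_, hb.2.2 c hc hcb⟩⟩
      rintro rfl
      exact hm.2 b (Finset.mem_insert_self _ _) hcb
    have hlt : #(L.erase m) < n := by
      rw [← hn]; exact Finset.card_erase_lt_of_mem hmL
    have e1 := ih _ hlt _ hL1 b hb1 rfl
    have e2 := ih _ hlt _ hL1 m (hmr.addable hL) rfl
    rw [Finset.insert_erase hmL] at e2
    rw [Finset.erase_insert_of_ne (Ne.symm hmb), e1, e2, ← mul_assoc, ← mul_assoc]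
    have h0 : A (lab m) (lab b) = 0 := by
      by_contra hne
      rcases h.comparable m (hL.1 hmL) b hb.1 hne with hle | hle
      · exact hm.2 b hbr.1 (lt_of_le_of_ne hle hmb)
      · exact hbr.2 m hm.1 (lt_of_le_of_ne hle (Ne.symm hmb))
    have hne : lab m ≠ lab b := by
      intro e; rw [e, h.diag] at h0; omega
    rw [braid_two cs]
    rcases h.off_diag _ _ hne with h' | h' | h' <;> omega

theorem elem_erase (L : Finset α) (hL : IsIdeal P L) (b : α) (hb : Removable L b) :
    cs.wordProd (word L) = cs.simple (lab b) * cs.wordProd (word (L.erase b)) := by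
  have := h.elem_insert cs hw _ (hL.erase hb) b (hb.addable hL)
  rwa [Finset.insert_erase hb.1] at this

omit hw in
theorem wt_erase (L : Finset α) (hL : IsIdeal P L) (b : α) (hb : Removable L b) (i : B) :
    wt P lab L i = wt P lab (L.erase b) i - A i (lab b) := by
  have := h.wt_insert (hL.erase hb) (hb.addable hL) i
  rwa [Finset.insert_erase hb.1] at this

omit hw [DecidableEq α] in
theorem exists_removable (L : Finset α) (hL : IsIdeal P L) {i : B} (hi : wt P lab L i < 0) :
    ∃ b, Removable L b ∧ lab b = i := by
  rcases wt_cases (P := P) (lab := lab) (L := L) i with h0 | ⟨b, hb, rfl⟩ | hb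
  · omega
  · rw [h.wt_addable hL hb] at hi; omega
  · exact hb

/-- Remove a maximal box, with label `k`. If `i` and `k` do not commute, the weight forces further
boxes with labels alternating between `i` and `k` to be removable, until a braid relation carries
`s_i` or `s_k` past them to a smaller ideal whose weight it fixes. For the empty ideal, `i` itself
is not `o`, since the weight at `o` is `1`. -/
theorem elem_stay (L : Finset α) (hL : IsIdeal P L) (i : B) (hi : wt P lab L i = 0) :
    ∃ j, j ≠ o ∧ cs.simple i * cs.wordProd (word L) = cs.wordProd (word L) * cs.simple j := by
  induction hn : #L using Nat.strong_induction_on generalizing L i with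
  | _ n ih =>
    rcases L.eq_empty_or_nonempty with rfl | hne
    · refine ⟨i, ?_, by simp [hw.1]⟩
      rintro rfl
      rw [h.wt_empty_self] at hi; omega
    obtain ⟨b, hb, -⟩ := hw.2 L hL hne
    set k := lab b with hk
    have hL1 := hL.erase hb
    have hlt : #(L.erase b) < n := by rw [← hn]; exact Finset.card_erase_lt_of_mem hb.1
    have e1 := h.elem_erase cs hw L hL b hb
    have w1 := h.wt_erase L hL b hb
    have wk := h.wt_removable hL hb
    rw [← hk] at e1 w1 wk
    have hik : i ≠ k := by rintro rfl; omega
    have wi1 := w1 i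
    have wk1 := w1 k
    have dk := h.diag k
    have di := h.diag i
    rcases h.off_diag i k hik with ⟨hm, h1, h2⟩ | ⟨hm, h1, h2⟩ | ⟨hm, ⟨h1, h2⟩ | ⟨h1, h2⟩⟩
    · obtain ⟨j, hj, e⟩ := ih _ hlt _ hL1 i (by omega) rfl
      refine ⟨j, hj, ?_⟩
      rw [e1, ← mul_assoc, braid_two cs hm, mul_assoc, e, mul_assoc]
    · obtain ⟨b', hb', ei⟩ := h.exists_removable _ hL1 (i := i) (by omega)
      have hL2 := hL1.erase hb'
      have hlt2 := (Finset.card_erase_lt_of_mem hb'.1).trans hlt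
      have e2 := h.elem_erase cs hw _ hL1 b' hb'
      have wk2 := h.wt_erase _ hL1 b' hb' k
      rw [ei] at e2 wk2
      obtain ⟨j, hj, e⟩ := ih _ hlt2 _ hL2 k (by omega) rfl
      refine ⟨j, hj, ?_⟩
      rw [e1, e2]
      have := braid_three cs hm
      calc cs.simple i * (cs.simple k * (cs.simple i * cs.wordProd (word ((L.erase b).erase b'))))
          = (cs.simple i * (cs.simple k * cs.simple i)) *
              cs.wordProd (word ((L.erase b).erase b')) := by
            simp only [mul_assoc]
        _ = cs.simple k * (cs.simple i * (cs.simple k *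
              cs.wordProd (word ((L.erase b).erase b')))) := by
            rw [this]; simp only [mul_assoc]
        _ = _ := by rw [e]; simp only [mul_assoc]
    · obtain ⟨b', hb', ei⟩ := h.exists_removable _ hL1 (i := i) (by omega)
      have hL2 := hL1.erase hb'
      have hlt2 := (Finset.card_erase_lt_of_mem hb'.1).trans hlt
      have e2 := h.elem_erase cs hw _ hL1 b' hb'
      have w2 := h.wt_erase _ hL1 b' hb'
      rw [ei] at e2 w2
      have wk2 := w2 k
      have wi2 := w2 i
      obtain ⟨b'', hb'', ek⟩ := h.exists_removable _ hL2 (i := k) (by omega)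
      have hL3 := hL2.erase hb''
      have hlt3 := (Finset.card_erase_lt_of_mem hb''.1).trans hlt2
      have e3 := h.elem_erase cs hw _ hL2 b'' hb''
      have wi3 := h.wt_erase _ hL2 b'' hb'' i
      rw [ek] at e3 wi3
      obtain ⟨j, hj, e⟩ := ih _ hlt3 _ hL3 i (by omega) rfl
      refine ⟨j, hj, ?_⟩
      rw [e1, e2, e3]
      have := braid_four cs hm
      generalize cs.wordProd (word (((L.erase b).erase b').erase b'')) = x at e
      calc cs.simple i * (cs.simple k * (cs.simple i * (cs.simple k * x)))
          = (cs.simple i * (cs.simple k * (cs.simple i * cs.simple k))) * x := by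
            simp only [mul_assoc]
        _ = cs.simple k * (cs.simple i * (cs.simple k * (cs.simple i * x))) := by
            rw [this]; simp only [mul_assoc]
        _ = _ := by rw [e]; simp only [mul_assoc]
    -- Here the smaller ideal would have weight `-2` at `i`, but weights of ideals lie in `{-1, 0,
    -- 1}`.
    · exfalso
      obtain ⟨b', hb', ei⟩ := h.exists_removable _ hL1 (i := i) (by omega)
      have := h.wt_removable hL1 hb'
      rw [ei] at this
      omega

theorem exists_factorization (w : W) : ∃ L, IsIdeal P L ∧ ∃ ω : List B, (∀ i ∈ ω, i ≠ o) ∧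
    w = cs.wordProd (word L) * cs.wordProd ω := by
  induction w using cs.simple_induction_left with
  | one => exact ⟨∅, isIdeal_empty, [], by simp, by simp [hw.1]⟩
  | mul_simple_left w i ih =>
    obtain ⟨L, hL, ω, hω, rfl⟩ := ih
    rcases wt_cases (P := P) (lab := lab) (L := L) i with h0 | ⟨b, hb, rfl⟩ | ⟨b, hb, rfl⟩
    · obtain ⟨j, hj, e⟩ := h.elem_stay cs hw L hL i h0
      refine ⟨L, hL, j :: ω, ?_, ?_⟩
      · simpa [hj] using hω
      · rw [← mul_assoc, e, cs.wordProd_cons, mul_assoc]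
    · exact ⟨_, hL.insert hb, ω, hω, by rw [h.elem_insert cs hw L hL b hb, mul_assoc]⟩
    · exact ⟨_, hL.erase hb, ω, hω, by
        rw [h.elem_erase cs hw L hL b hb, mul_assoc, cs.simple_mul_simple_cancel_left]⟩

/-- Multiplying on the right by `s_j` in `J` leaves the resulting state unchanged, so the length is
still at least the number of boxes, which is the length of the element itself. -/
theorem elem_mem_minimalReps (L : Finset α) (hL : IsIdeal P L) :
    cs.wordProd (word L) ∈ cs.minimalReps {i | i ≠ o} := by
  intro j hj
  refine lt_of_le_of_ne ?_ (cs.length_mul_simple_ne _ j).symm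
  rw [h.length_elem cs hw L hL]
  refine h.card_le_length cs _ L hL ?_
  have e := h.rep_parabolic cs (ω := [j]) (by simpa using hj)
  rw [cs.wordProd_singleton] at e
  rw [rep_mul, e, h.rep_word cs hw L hL]

theorem exists_eq_elem (w : W) (hwm : w ∈ cs.minimalReps {i | i ≠ o}) :
    ∃ L, IsIdeal P L ∧ cs.wordProd (word L) = w := by
  induction hn : cs.length w generalizing w with
  | zero => exact ⟨∅, isIdeal_empty, by simp [hw.1, cs.length_eq_zero_iff.1 hn]⟩
  | succ n ih =>
    obtain ⟨i, hi⟩ := cs.exists_leftDescent_of_ne_one (w := w) (by rintro rfl; simp at hn)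
    rw [cs.isLeftDescent_iff] at hi
    have hm : cs.simple i * w ∈ cs.minimalReps {i | i ≠ o} := by
      intro j hj
      have h1 := hwm j hj
      have h2 := cs.length_simple_mul (w * cs.simple j) i
      rw [mul_assoc]
      omega
    obtain ⟨L, hL, e⟩ := ih _ hm (by omega)
    have ew : w = cs.simple i * cs.wordProd (word L) := by rw [e, cs.simple_mul_simple_cancel_left]
    have hlen := h.length_elem cs hw L hL
    rw [e] at hlen
    -- Only adding a box is possible: if `s_i` fixes the weight, then `w = w_L s_j` has a right
    -- descent in `J`; if it removes a box, `w` is shorter than `w_L`.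
    rcases wt_cases (P := P) (lab := lab) (L := L) i with h0 | ⟨b, hb, rfl⟩ | ⟨b, hb, rfl⟩
    · exfalso
      obtain ⟨j, hj, e'⟩ := h.elem_stay cs hw L hL i h0
      have h1 := hwm j hj
      rw [ew, e', cs.simple_mul_simple_cancel_right, ← e', ← ew, e] at h1
      omega
    · exact ⟨_, hL.insert hb, by rw [h.elem_insert cs hw L hL b hb, ew]⟩
    · exfalso
      have h1 := h.length_elem cs hw _ (hL.erase hb)
      rw [h.elem_erase cs hw L hL b hb, cs.simple_mul_simple_cancel_left] at ew
      rw [← ew, Finset.card_erase_of_mem hb.1] at h1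
      omega

theorem subset_of_sublist (L : Finset α) (hL : IsIdeal P L) {ω : List B}
    (hω : ω.Sublist (word L)) : ∃ K, IsIdeal P K ∧ K ⊆ L ∧
      h.rep cs (cs.wordProd ω) (state P lab ∅) = state P lab K := by
  induction hn : #L generalizing L ω with
  | zero =>
    rw [Finset.card_eq_zero.1 hn, hw.1, List.sublist_nil] at hω
    exact ⟨∅, isIdeal_empty, by simp, by rw [hω]; simp; rfl⟩
  | succ n ih =>
    obtain ⟨m, hm, e⟩ := hw.2 L hL (Finset.card_pos.1 (by omega))
    rw [e, List.sublist_cons_iff] at hω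
    have hc : #(L.erase m) = n := by rw [Finset.card_erase_of_mem hm.1]; omega
    rcases hω with hω | ⟨ω', rfl, hω⟩
    · obtain ⟨K, hK, hKL, e'⟩ := ih _ (hL.erase hm) hω hc
      exact ⟨K, hK, hKL.trans (Finset.erase_subset _ _), e'⟩
    obtain ⟨K, hK, hKL, e'⟩ := ih _ (hL.erase hm) hω hc
    have hKL' := hKL.trans (Finset.erase_subset _ _)
    rw [cs.wordProd_cons, rep_simple_mul, e']
    rcases wt_cases (P := P) (lab := lab) (L := K) (lab m) with h0 | ⟨b, hb, eb⟩ | ⟨b, hb, eb⟩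
    · exact ⟨K, hK, hKL', step_state_zero h0⟩
    · refine ⟨_, hK.insert hb, Finset.insert_subset ?_ hKL', ?_⟩
      -- The added box `b` has the label of `m`, so the two are comparable. It cannot lie strictly
      -- above `m`, because `m` is missing from `K`; so `b ≤ m` and `b` is in `L`.
      · rcases h.comparable b hb.1 m (hL.1 hm.1) (by rw [eb, h.diag]; omega) with hle | hle
        · exact hL.2 m hm.1 b hb.1 hle
        · rcases hle.eq_or_lt with rfl | hlt
          · exact hm.1
          · exact absurd rfl (Finset.ne_of_mem_erase (hKL (hb.2.2 m (hL.1 hm.1) hlt)))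
      · rw [← eb]; exact h.step_state_addable hK hb
    · refine ⟨_, hK.erase hb, (Finset.erase_subset _ _).trans hKL', ?_⟩
      rw [← eb]; exact h.step_state_removable hK hb

/-- A Bruhat chain may leave `W^J`, so the claim is about arbitrary elements and the ideals they
reach. Write the larger element of a step as `w_L` times a word in `J`; strong exchange makes the
smaller one a subword, and its part in `J` fixes the state of the empty ideal. -/
theorem subset_of_bruhatLE {u v : W} (huv : cs.BruhatLE u v) {K L : Finset α}
    (hK : IsIdeal P K) (hL : IsIdeal P L)
    (eu : h.rep cs u (state P lab ∅) = state P lab K)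
    (ev : h.rep cs v (state P lab ∅) = state P lab L) : K ⊆ L := by
  induction huv generalizing L with
  | refl => exact (h.state_injective hK hL (eu.symm.trans ev)).subset
  | @tail x y hux hxy ih =>
    obtain ⟨hlt, t, ht, rfl⟩ := hxy
    obtain ⟨L', hL', ω, hω, e⟩ := h.exists_factorization cs hw (t * x)
    have e' : h.rep cs (t * x) (state P lab ∅) = state P lab L' := by
      rw [e, rep_mul, h.rep_parabolic cs hω, h.rep_word cs hw L' hL']
    obtain rfl := h.state_injective hL hL' (ev.symm.trans e')
    rw [← cs.wordProd_append] at e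
    have hx : t * (t * x) = x := by rw [← mul_assoc, ht.mul_self, one_mul]
    have hinv : cs.IsLeftInversion (cs.wordProd (word L ++ ω)) t :=
      ⟨ht, by rw [← e, hx]; exact hlt⟩
    obtain ⟨ω', hsub, e2⟩ := hinv.exists_sublist
    rw [← e, hx] at e2
    obtain ⟨ω₁, ω₂, rfl, h1, h2⟩ := List.sublist_append_iff.1 hsub
    obtain ⟨K', hK', hKL, e3⟩ := h.subset_of_sublist cs hw L hL h1
    refine (ih hK' ?_).trans hKL
    rw [e2, cs.wordProd_append, rep_mul, h.rep_parabolic cs fun i hi ↦ hω i (h2.subset hi), e3]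

theorem leftWeakLE_of_subset (K L : Finset α) (hK : IsIdeal P K) (hL : IsIdeal P L)
    (hKL : K ⊆ L) : cs.LeftWeakLE (cs.wordProd (word K)) (cs.wordProd (word L)) := by
  induction hn : #(L \ K) generalizing K with
  | zero =>
    rw [Finset.card_eq_zero, Finset.sdiff_eq_empty_iff_subset] at hn
    rw [hKL.antisymm hn]
    exact Relation.ReflTransGen.refl
  | succ n ih =>
    -- A minimal box of the difference can be added to `K` without leaving `L`.
    obtain ⟨b, hbm⟩ := (L \ K).exists_minimal (Finset.card_pos.1 (by omega))
    have hbL := Finset.mem_sdiff.1 hbm.prop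
    have hb : Addable P K b := by
      refine ⟨hL.1 hbL.1, hbL.2, fun c hc hcb ↦ ?_⟩
      by_contra hcK
      exact hbm.not_lt (Finset.mem_sdiff.2 ⟨hL.2 b hbL.1 c hc hcb.le, hcK⟩) hcb
    have hK' := hK.insert hb
    refine Relation.ReflTransGen.head ⟨?_, lab b, ?_⟩
      (ih _ hK' (Finset.insert_subset hbL.1 hKL) ?_)
    · rw [h.length_elem cs hw K hK, h.length_elem cs hw _ hK',
        Finset.card_insert_of_notMem hb.2.1]
      omega
    · exact (h.elem_insert cs hw K hK b hb).symm
    · rw [Finset.sdiff_insert, Finset.card_erase_of_mem hbm.prop]; omega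

omit h hw [PartialOrder α] [DecidableEq α] in
theorem bruhatLE_of_leftWeakLE {u v : W} (huv : cs.LeftWeakLE u v) : cs.BruhatLE u v :=
  Relation.ReflTransGen.mono
    (fun _ _ hxy ↦ ⟨hxy.1, hxy.2.imp' cs.simple fun i e ↦ ⟨cs.isReflection_simple i, e⟩⟩) _ _ huv

theorem subset_iff_bruhatLE (K L : Finset α) (hK : IsIdeal P K) (hL : IsIdeal P L) :
    K ⊆ L ↔ cs.BruhatLE (cs.wordProd (word K)) (cs.wordProd (word L)) :=
  ⟨fun hKL ↦ bruhatLE_of_leftWeakLE cs (h.leftWeakLE_of_subset cs hw K L hK hL hKL),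
    fun hb ↦ h.subset_of_bruhatLE cs hw hb hK hL (h.rep_word cs hw K hK) (h.rep_word cs hw L hL)⟩

theorem subset_iff_leftWeakLE (K L : Finset α) (hK : IsIdeal P K) (hL : IsIdeal P L) :
    K ⊆ L ↔ cs.LeftWeakLE (cs.wordProd (word K)) (cs.wordProd (word L)) :=
  ⟨h.leftWeakLE_of_subset cs hw K L hK hL, fun hb ↦
    (h.subset_iff_bruhatLE cs hw K L hK hL).2 (bruhatLE_of_leftWeakLE cs hb)⟩

/-- The bijection from the ideals onto the minimal coset representatives. -/
noncomputable def elemEquiv : {L : Finset α // IsIdeal P L} ≃ cs.minimalReps {i | i ≠ o} :=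
  Equiv.ofBijective
    (fun L ↦ ⟨cs.wordProd (word L.1), h.elem_mem_minimalReps cs hw L.1 L.2⟩) <| by
    constructor
    · rintro ⟨L, hL⟩ ⟨K, hK⟩ e
      have e' : cs.wordProd (word L) = cs.wordProd (word K) := congrArg Subtype.val e
      apply Subtype.ext
      apply h.state_injective hL hK
      rw [← h.rep_word cs hw L hL, e', h.rep_word cs hw K hK]
    · rintro ⟨w, hwm⟩
      obtain ⟨L, hL, e⟩ := h.exists_eq_elem cs hw w hwm
      exact ⟨⟨L, hL⟩, Subtype.ext e⟩

end Elements

end IsMinusculeHeap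

/-! ### Reading by rows, and the heap conditions in coordinates -/

theorem Finset.sort_eq_sort_erase_append {β : Type*} [LinearOrder β] {S : Finset β} {m : β}
    (hm : m ∈ S) (hmax : ∀ b ∈ S, b ≤ m) : S.sort = (S.erase m).sort ++ [m] := by
  refine List.Perm.eq_of_pairwise (le := (· ≤ ·)) (fun a b _ _ ↦ le_antisymm)
    (S.pairwise_sort _) ?_ ?_
  · rw [List.pairwise_append]
    refine ⟨(S.erase m).pairwise_sort _, List.pairwise_singleton _ _, fun a ha b hb ↦ ?_⟩
    rw [List.mem_singleton.1 hb]
    exact hmax a (Finset.mem_of_mem_erase ((Finset.mem_sort _).1 ha))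
  · rw [List.perm_ext_iff_of_nodup (S.sort_nodup _)]
    · intro a
      simp only [Finset.mem_sort, List.mem_append, List.mem_singleton, Finset.mem_erase]
      by_cases h : a = m
      · simp [h, hm]
      · simp [h]
    · rw [List.nodup_append]
      refine ⟨(S.erase m).sort_nodup _, List.nodup_singleton _, fun a ha b hb ↦ ?_⟩
      rw [List.mem_singleton.1 hb]
      exact Finset.ne_of_mem_erase ((Finset.mem_sort _).1 ha)

namespace HermitianPair

/-- The lexicographic order extends the componentwise order, so the last box of the row reading is
maximal. The reversal puts its label first. -/
theorem isReading_rowWord (T : HermitianPair) :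
    IsMinusculeHeap.IsReading T.boxes (fun b ↦ T.node (T.label b))
      fun L ↦ (T.rowWord L).reverse := by
  refine ⟨by simp [rowWord], fun L _ hne ↦ ?_⟩
  obtain ⟨m, hm, hmax⟩ := (L.map toLex.toEmbedding).exists_max_image id (by simpa using hne)
  simp only [id] at hmax
  have hmL : ofLex m ∈ L := by
    obtain ⟨x, hx, rfl⟩ := Finset.mem_map.1 hm
    exact hx
  refine ⟨ofLex m, ⟨hmL, fun c hc hlt ↦ ?_⟩, ?_⟩
  · have h1 := hmax (toLex c) (Finset.mem_map.2 ⟨c, hc, rfl⟩)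
    have h2 : m ≤ toLex c := Prod.Lex.toLex_mono hlt.le
    exact hlt.ne (congrArg ofLex (h2.antisymm h1))
  · have e : (L.erase (ofLex m)).map toLex.toEmbedding = (L.map toLex.toEmbedding).erase m := by
      rw [Finset.map_erase]; rfl
    simp only [rowWord]
    rw [Finset.sort_eq_sort_erase_append hm hmax, e]
    simp

/-- The box `c` is strictly below `b` in the componentwise order. -/
def Below (c b : ℕ × ℕ) : Prop := c.1 ≤ b.1 ∧ c.2 ≤ b.2 ∧ c.1 + c.2 < b.1 + b.2

instance (c b : ℕ × ℕ) : Decidable (Below c b) := inferInstanceAs (Decidable (_ ∧ _))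

theorem lt_iff_below (c b : ℕ × ℕ) : c < b ↔ Below c b := by
  rw [Prod.lt_iff, Below]; omega

theorem node_val {T : HermitianPair} {k : ℕ} (h1 : 1 ≤ k) (h2 : k ≤ T.rank) :
    (T.node k : ℕ) + 1 = k := by
  simp only [node]
  rw [Nat.mod_eq_of_lt (by omega)]; omega

/-- With labels as Bourbaki numbers and the order spelled out in coordinates, the conditions become
linear arithmetic for the infinite families and finite checks for `E6` and `E7`. -/
theorem isMinusculeHeap_of_labels (T : HermitianPair) (A : ℕ → ℕ → ℤ)
    (diag : ∀ i, A i i = 2)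
    (off_diag : ∀ i j : Fin T.rank, i ≠ j →
      (T.coxeterMatrix i j = 2 ∧ A (i + 1) (j + 1) = 0 ∧ A (j + 1) (i + 1) = 0) ∨
      (T.coxeterMatrix i j = 3 ∧ A (i + 1) (j + 1) = -1 ∧ A (j + 1) (i + 1) = -1) ∨
      (T.coxeterMatrix i j = 4 ∧ (A (i + 1) (j + 1) = -1 ∧ A (j + 1) (i + 1) = -2 ∨
        A (i + 1) (j + 1) = -2 ∧ A (j + 1) (i + 1) = -1)))
    (bot : (1, 1) ∈ T.boxes ∧ T.label (1, 1) = T.omitted ∧ ∀ c ∈ T.boxes, 1 ≤ c.1 ∧ 1 ≤ c.2)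
    (between : ∀ c ∈ T.boxes, ∀ b ∈ T.boxes, Below c b → 0 ≤ A (T.label c) (T.label b) →
      ∃ e ∈ T.boxes, Below c e ∧ Below e b)
    (comparable : ∀ c ∈ T.boxes, ∀ b ∈ T.boxes, A (T.label c) (T.label b) ≠ 0 →
      (c.1 ≤ b.1 ∧ c.2 ≤ b.2) ∨ (b.1 ≤ c.1 ∧ b.2 ≤ c.2))
    (other : ∀ c ∈ T.boxes, ∀ b ∈ T.boxes, Below c b → A (T.label c) (T.label b) = -1 →
      ∀ d ∈ T.boxes, Below b d → T.label c = T.label d →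
      ∃ e ∈ T.boxes, e ≠ b ∧ Below c e ∧ Below e d)
    (double : ∀ i ∈ Icc 1 T.rank, ∀ b ∈ T.boxes, A i (T.label b) = -2 →
      (∃ c ∈ T.boxes, T.label c = i ∧ Below c b ∧
        ∀ e ∈ T.boxes, Below c e → b.1 ≤ e.1 ∧ b.2 ≤ e.2) ∧
      (∃ d ∈ T.boxes, T.label d = i ∧ Below b d ∧
        ∀ e ∈ T.boxes, Below e d → e.1 ≤ b.1 ∧ e.2 ≤ b.2))
    (single : ∀ i ∈ Icc 1 T.rank, ∀ b ∈ T.boxes, A i (T.label b) = -1 →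
      (∃ c ∈ T.boxes, T.label c = i ∧ Below c b ∧
        ∀ e ∈ T.boxes, Below c e → b.1 ≤ e.1 ∧ b.2 ≤ e.2) ∨
      (∃ d ∈ T.boxes, T.label d = i ∧ Below b d ∧
        ∀ e ∈ T.boxes, Below e d → e.1 ≤ b.1 ∧ e.2 ≤ b.2) ∨
      (∃ c ∈ T.boxes, T.label c = i ∧ Below c b ∧ ∃ d ∈ T.boxes, T.label d = i ∧ Below b d ∧
        ∀ e ∈ T.boxes, Below e d → ∀ f ∈ T.boxes, Below c f →
          (e.1 ≤ b.1 ∧ e.2 ≤ b.2) ∨ (b.1 ≤ f.1 ∧ b.2 ≤ f.2) ∨ (e.1 ≤ f.1 ∧ e.2 ≤ f.2))) :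
    IsMinusculeHeap T.coxeterMatrix (fun i j ↦ A (i + 1) (j + 1)) T.boxes
      (fun b ↦ T.node (T.label b)) (T.node T.omitted) := by
  have lab {b} (hb : b ∈ T.boxes) : (T.node (T.label b) : ℕ) + 1 = T.label b :=
    node_val (T.label_mem b hb).1 (T.label_mem b hb).2
  have lab_eq {b} (hb : b ∈ T.boxes) (i : Fin T.rank) :
      T.node (T.label b) = i ↔ T.label b = i + 1 := by
    have := lab hb
    rw [Fin.ext_iff]; omega
  have mem (i : Fin T.rank) : (i : ℕ) + 1 ∈ Icc 1 T.rank := by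
    have := i.2
    rw [mem_Icc]; omega
  refine ⟨fun i ↦ diag _, off_diag, ⟨(1, 1), bot.1, by rw [bot.2.1], fun c hc ↦ bot.2.2 c hc⟩,
    fun c hc b hb hcb h0 ↦ ?_, fun c hc b hb h0 ↦ ?_,
    fun c hc b hb d hd hcb hbd hcd h1 ↦ ?_, fun i b hb h2 ↦ ?_, fun i b hb h1 ↦ ?_⟩
  · simp only [lt_iff_below] at hcb ⊢
    rw [lab hc, lab hb] at h0
    exact between c hc b hb hcb h0
  · rw [lab hc, lab hb] at h0
    exact comparable c hc b hb h0
  · simp only [lt_iff_below] at hcb hbd ⊢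
    rw [lab hc, lab hb] at h1
    refine other c hc b hb hcb h1 d hd hbd ?_
    rw [← lab hc, ← lab hd, hcd]
  · rw [lab hb] at h2
    simp only [lt_iff_below, Prod.le_def]
    obtain ⟨⟨c, hc, e, h3⟩, d, hd, e', h4⟩ := double _ (mem i) b hb h2
    exact ⟨⟨c, hc, (lab_eq hc i).2 e, h3⟩, d, hd, (lab_eq hd i).2 e', h4⟩
  · rw [lab hb] at h1
    simp only [lt_iff_below, Prod.le_def]
    rcases single _ (mem i) b hb h1 with ⟨c, hc, e, h3⟩ | ⟨d, hd, e', h4⟩ |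
      ⟨c, hc, e, h3, d, hd, e', h4⟩
    · exact .inl ⟨c, hc, (lab_eq hc i).2 e, h3⟩
    · exact .inr (.inl ⟨d, hd, (lab_eq hd i).2 e', h4⟩)
    · exact .inr (.inr ⟨c, hc, (lab_eq hc i).2 e, h3, d, hd, (lab_eq hd i).2 e', h4⟩)

/-! ### Verification of the heap conditions, type by type -/

/-- The Cartan matrices, indexed by the Bourbaki numbers of the simple reflections, for which the
diagram of Hermitian type consists of the weights of a minuscule representation. -/
def cartan (T : HermitianPair) (i j : ℕ) : ℤ :=
  if i = j then 2 else
  match T with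
  | A _ _ _ _ => if i + 1 = j ∨ j + 1 = i then -1 else 0
  | C n _ => if i = n ∧ j + 1 = n then -2 else if i + 1 = j ∨ j + 1 = i then -1 else 0
  | B n _ => if j = n ∧ i + 1 = n then -2 else if i + 1 = j ∨ j + 1 = i then -1 else 0
  | DA n _ | DD n _ =>
    if (i + 1 = j ∧ j < n) ∨ (j + 1 = i ∧ i < n) ∨ (i + 2 = j ∧ j = n) ∨ (j + 2 = i ∧ i = n)
    then -1 else 0
  | E6 | E7 =>
    if (i = 1 ∧ j = 3) ∨ (i = 3 ∧ j = 1) ∨ (i = 2 ∧ j = 4) ∨ (i = 4 ∧ j = 2) ∨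
      (3 ≤ i ∧ i + 1 = j) ∨ (3 ≤ j ∧ j + 1 = i) then -1 else 0

/-- The boxes of the diagram of Hermitian type form a minuscule heap. -/
abbrev IsHeap (T : HermitianPair) : Prop :=
  IsMinusculeHeap T.coxeterMatrix (fun i j ↦ T.cartan (i + 1) (j + 1)) T.boxes
    (fun b ↦ T.node (T.label b)) (T.node T.omitted)

theorem coxeterMatrix_E6 : ∀ p : Fin 6 × Fin 6, p.1 ≠ p.2 →
    (CoxeterMatrix.E₆.M p.1 p.2 = 2 ∧ E6.cartan (p.1 + 1) (p.2 + 1) = 0 ∧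
      E6.cartan (p.2 + 1) (p.1 + 1) = 0) ∨
    (CoxeterMatrix.E₆.M p.1 p.2 = 3 ∧ E6.cartan (p.1 + 1) (p.2 + 1) = -1 ∧
      E6.cartan (p.2 + 1) (p.1 + 1) = -1) := by
  decide +kernel

set_option synthInstance.maxSize 2000 in
theorem isHeap_E6 : E6.IsHeap := by
  refine isMinusculeHeap_of_labels _ _ (fun i ↦ by simp [cartan])
    (fun i j hij ↦ (coxeterMatrix_E6 (i, j) hij).imp_right Or.inl) ?_ ?_ ?_ ?_ ?_ ?_
  all_goals decide +kernel

theorem coxeterMatrix_E7 : ∀ p : Fin 7 × Fin 7, p.1 ≠ p.2 →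
    (CoxeterMatrix.E₇.M p.1 p.2 = 2 ∧ E7.cartan (p.1 + 1) (p.2 + 1) = 0 ∧
      E7.cartan (p.2 + 1) (p.1 + 1) = 0) ∨
    (CoxeterMatrix.E₇.M p.1 p.2 = 3 ∧ E7.cartan (p.1 + 1) (p.2 + 1) = -1 ∧
      E7.cartan (p.2 + 1) (p.1 + 1) = -1) := by
  decide +kernel

set_option synthInstance.maxSize 2000 in
theorem isHeap_E7 : E7.IsHeap := by
  refine isMinusculeHeap_of_labels _ _ (fun i ↦ by simp [cartan])
    (fun i j hij ↦ (coxeterMatrix_E7 (i, j) hij).imp_right Or.inl) ?_ ?_ ?_ ?_ ?_ ?_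
  all_goals decide +kernel

/-- This is the heap of the `p`-th exterior power of the standard representation. -/
theorem isHeap_A (n p : ℕ) (hp : 1 ≤ p) (hpn : p ≤ n) : (A n p hp hpn).IsHeap := by
  have mem (c : ℕ × ℕ) : c ∈ (A n p hp hpn).boxes ↔
      1 ≤ c.1 ∧ c.1 + p ≤ n + 1 ∧ 1 ≤ c.2 ∧ c.2 ≤ p := by
    simp only [boxes, mem_product, mem_Icc]; omega
  have hlab (c : ℕ × ℕ) : (A n p hp hpn).label c = p + c.1 - c.2 := rfl
  have cart0 (i j : ℕ) (h : 0 ≤ (A n p hp hpn).cartan i j) : i + 1 ≠ j ∧ j + 1 ≠ i := by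
    simp only [cartan] at h; split_ifs at h <;> omega
  have cart1 (i j : ℕ) (h : (A n p hp hpn).cartan i j = -1) : i + 1 = j ∨ j + 1 = i := by
    simp only [cartan] at h; split_ifs at h; omega
  refine isMinusculeHeap_of_labels _ _ (fun i ↦ by simp [cartan]) ?_ ?_ ?_ ?_ ?_ ?_ ?_
  · intro i j hij
    have hij' : (i : ℕ) ≠ j := Fin.val_ne_of_ne hij
    have hM : (A n p hp hpn).coxeterMatrix i j =
        if i = j then 1 else if (j : ℕ) + 1 = i ∨ (i : ℕ) + 1 = j then 3 else 2 := rfl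
    simp only [hM, if_neg hij, cartan]
    split_ifs <;> omega
  · refine ⟨?_, ?_, fun c hc ↦ ?_⟩
    · rw [mem]; omega
    · rw [hlab, omitted]; omega
    · rw [mem] at hc; omega
  · rintro ⟨x, y⟩ hc ⟨z, w⟩ hb hcb h0
    have := cart0 _ _ h0
    simp only [mem, hlab, Below] at *
    by_cases hx : x < z
    · exact ⟨(x + 1, y), by dsimp only; omega⟩
    · exact ⟨(x, y + 1), by dsimp only; omega⟩
  · rintro ⟨x, y⟩ hc ⟨z, w⟩ hb h0
    have : ∀ i j, (A n p hp hpn).cartan i j ≠ 0 → i = j ∨ i + 1 = j ∨ j + 1 = i := by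
      intro i j h; simp only [cartan] at h; split_ifs at h <;> omega
    have := this _ _ h0
    simp only [mem, hlab] at *
    omega
  · rintro ⟨x, y⟩ hc ⟨z, w⟩ hb hcb h1 ⟨x', y'⟩ hd hbd hcd
    have := cart1 _ _ h1
    simp only [mem, hlab, Below, ne_eq] at *
    by_cases hx : z = x + 1 ∧ w = y
    · exact ⟨(x, y + 1), by simp only [Prod.mk.injEq]; omega⟩
    · exact ⟨(x + 1, y), by simp only [Prod.mk.injEq]; omega⟩
  · intro i _ b _ h2
    exfalso
    simp only [cartan] at h2; split_ifs at h2; omega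
  · rintro i hi ⟨x, y⟩ hb h1
    have := cart1 _ _ h1
    simp only [mem_Icc, rank] at hi
    simp only [Prod.exists, Prod.forall, mem, hlab, Below] at *
    -- The label drops by one upwards and to the right, and grows by one downwards and to the left.
    -- Both neighbours are missing only at a corner, where `i` would be `0` or `n + 1`.
    rcases this with h | h
    · by_cases hx : x = 1
      · exact .inr (.inl ⟨x, y + 1, by omega, by omega, by omega, fun _ _ _ _ ↦ by omega⟩)
      by_cases hy : y = p
      · exact .inl ⟨x - 1, y, by omega, by omega, by omega, fun _ _ _ _ ↦ by omega⟩
      · exact .inr (.inr ⟨x - 1, y, by omega, by omega, by omega, x, y + 1, by omega,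
          by omega, by omega, fun _ _ _ _ _ _ _ _ ↦ by omega⟩)
    · by_cases hx : y = 1
      · exact .inr (.inl ⟨x + 1, y, by omega, by omega, by omega, fun _ _ _ _ ↦ by omega⟩)
      by_cases hy : x + p = n + 1
      · exact .inl ⟨x, y - 1, by omega, by omega, by omega, fun _ _ _ _ ↦ by omega⟩
      · exact .inr (.inr ⟨x, y - 1, by omega, by omega, by omega, x + 1, y, by omega,
          by omega, by omega, fun _ _ _ _ _ _ _ _ ↦ by omega⟩)

/-- The Cartan matrix has a short last root, so it is of type `B_n`, and the staircase is the heap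
of its spin representation. The Coxeter group is the same. -/
theorem isHeap_C (n : ℕ) (hn : 2 ≤ n) : (C n hn).IsHeap := by
  have mem (c : ℕ × ℕ) : c ∈ (C n hn).boxes ↔ 1 ≤ c.1 ∧ c.1 ≤ c.2 ∧ c.2 ≤ n := by
    simp only [boxes, mem_filter, mem_product, mem_Icc]; omega
  have hlab (c : ℕ × ℕ) : (C n hn).label c = n + c.1 - c.2 := rfl
  have cart0 (i j : ℕ) (h : 0 ≤ (C n hn).cartan i j) : i + 1 ≠ j ∧ j + 1 ≠ i := by
    simp only [cartan] at h; split_ifs at h <;> omega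
  have cart1 (i j : ℕ) (h : (C n hn).cartan i j = -1) :
      (i + 1 = j ∨ j + 1 = i) ∧ ¬ (i = n ∧ j + 1 = n) := by
    simp only [cartan] at h; split_ifs at h <;> omega
  have cart2 (i j : ℕ) (h : (C n hn).cartan i j = -2) : i = n ∧ j + 1 = n := by
    simp only [cartan] at h; split_ifs at h <;> omega
  have cart3 (i j : ℕ) (h : (C n hn).cartan i j ≠ 0) : i = j ∨ i + 1 = j ∨ j + 1 = i := by
    simp only [cartan] at h; split_ifs at h <;> omega
  refine isMinusculeHeap_of_labels _ _ (fun i ↦ by simp [cartan]) ?_ ?_ ?_ ?_ ?_ ?_ ?_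
  · intro i j hij
    have hij' : (i : ℕ) ≠ j := Fin.val_ne_of_ne hij
    have hi : (i : ℕ) < n := i.2
    have hj : (j : ℕ) < n := j.2
    have hM : (C n hn).coxeterMatrix i j =
        if i = j then 1 else
          if (i : ℕ) = n - 1 ∧ (j : ℕ) = n - 2 ∨ (j : ℕ) = n - 1 ∧ (i : ℕ) = n - 2 then 4 else
          if (j : ℕ) + 1 = i ∨ (i : ℕ) + 1 = j then 3 else 2 := rfl
    simp only [hM, if_neg hij, cartan]
    split_ifs <;> omega
  · refine ⟨?_, ?_, fun c hc ↦ ?_⟩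
    · rw [mem]; omega
    · rw [hlab, omitted]; omega
    · rw [mem] at hc; omega
  · rintro ⟨x, y⟩ hc ⟨z, w⟩ hb hcb h0
    have := cart0 _ _ h0
    simp only [mem, hlab, Below] at *
    by_cases hx : y < w
    · exact ⟨(x, y + 1), by dsimp only; omega⟩
    · exact ⟨(x + 1, y), by dsimp only; omega⟩
  · rintro ⟨x, y⟩ hc ⟨z, w⟩ hb h0
    have := cart3 _ _ h0
    simp only [mem, hlab] at *
    omega
  · rintro ⟨x, y⟩ hc ⟨z, w⟩ hb hcb h1 ⟨x', y'⟩ hd hbd hcd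
    have := cart1 _ _ h1
    simp only [mem, hlab, Below, ne_eq] at *
    by_cases hx : z = x + 1 ∧ w = y
    · exact ⟨(x, y + 1), by simp only [Prod.mk.injEq]; omega⟩
    · exact ⟨(x + 1, y), by simp only [Prod.mk.injEq]; omega⟩
  · rintro i hi ⟨x, y⟩ hb h2
    have := cart2 _ _ h2
    simp only [Prod.exists, Prod.forall, mem, hlab, Below] at *
    exact ⟨⟨x, x, by omega, by omega, by omega, fun _ _ _ _ ↦ by omega⟩,
      ⟨y, y, by omega, by omega, by omega, fun _ _ _ _ ↦ by omega⟩⟩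
  · rintro i hi ⟨x, y⟩ hb h1
    have := cart1 _ _ h1
    simp only [mem_Icc, rank] at hi
    simp only [Prod.exists, Prod.forall, mem, hlab, Below] at *
    rcases this.1 with h | h
    · by_cases hx : x = 1
      · exact .inr (.inl ⟨x, y + 1, by omega, by omega, by omega, fun _ _ _ _ ↦ by omega⟩)
      by_cases hy : y = n
      · exact .inl ⟨x - 1, y, by omega, by omega, by omega, fun _ _ _ _ ↦ by omega⟩
      · exact .inr (.inr ⟨x - 1, y, by omega, by omega, by omega, x, y + 1, by omega, by omega,
          by omega, fun _ _ _ _ _ _ _ _ ↦ by omega⟩)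
    · exact .inr (.inr ⟨x, y - 1, by omega, by omega, by omega, x + 1, y, by omega, by omega,
          by omega, fun _ _ _ _ _ _ _ _ ↦ by omega⟩)

/-- Dually, the last root is long here, and the chain is the heap of the `2n`-dimensional
representation of type `C_n`. -/
theorem isHeap_B (n : ℕ) (hn : 2 ≤ n) : (B n hn).IsHeap := by
  have mem (c : ℕ × ℕ) : c ∈ (B n hn).boxes ↔
      (c.1 = 1 ∧ 1 ≤ c.2 ∧ c.2 ≤ n) ∨ (2 ≤ c.1 ∧ c.1 ≤ n ∧ c.2 = n) := by
    simp only [boxes, mem_union, mem_product, mem_Icc, mem_singleton]; omega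
  have hlab (c : ℕ × ℕ) : (B n hn).label c = if c.1 = 1 then c.2 else n + 1 - c.1 := rfl
  have cart0 (i j : ℕ) (h : 0 ≤ (B n hn).cartan i j) : i + 1 ≠ j ∧ j + 1 ≠ i := by
    simp only [cartan] at h; split_ifs at h <;> omega
  have cart1 (i j : ℕ) (h : (B n hn).cartan i j = -1) :
      (i + 1 = j ∨ j + 1 = i) ∧ ¬ (j = n ∧ i + 1 = n) := by
    simp only [cartan] at h; split_ifs at h <;> omega
  have cart2 (i j : ℕ) (h : (B n hn).cartan i j = -2) : j = n ∧ i + 1 = n := by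
    simp only [cartan] at h; split_ifs at h <;> omega
  refine isMinusculeHeap_of_labels _ _ (fun i ↦ by simp [cartan]) ?_ ?_ ?_ ?_ ?_ ?_ ?_
  · intro i j hij
    have hij' : (i : ℕ) ≠ j := Fin.val_ne_of_ne hij
    have hi : (i : ℕ) < n := i.2
    have hj : (j : ℕ) < n := j.2
    have hM : (B n hn).coxeterMatrix i j =
        if i = j then 1 else
          if (i : ℕ) = n - 1 ∧ (j : ℕ) = n - 2 ∨ (j : ℕ) = n - 1 ∧ (i : ℕ) = n - 2 then 4 else
          if (j : ℕ) + 1 = i ∨ (i : ℕ) + 1 = j then 3 else 2 := rfl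
    simp only [hM, if_neg hij, cartan]
    split_ifs <;> omega
  · refine ⟨?_, ?_, fun c hc ↦ ?_⟩
    · rw [mem]; omega
    · rw [hlab, omitted]; simp
    · rw [mem] at hc; omega
  · rintro ⟨x, y⟩ hc ⟨z, w⟩ hb hcb h0
    have := cart0 _ _ h0
    simp only [mem, hlab, Below] at *
    by_cases hx : y < n
    · exact ⟨(x, y + 1), by dsimp only; split_ifs at this <;> omega⟩
    · exact ⟨(x + 1, y), by dsimp only; split_ifs at this <;> omega⟩
  · rintro ⟨x, y⟩ hc ⟨z, w⟩ hb h0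
    simp only [mem] at *
    omega
  · rintro ⟨x, y⟩ hc ⟨z, w⟩ hb hcb h1 ⟨x', y'⟩ hd hbd hcd
    have := cart1 _ _ h1
    simp only [mem, hlab, Below, ne_eq] at *
    -- The box `d` is `(n + 1 - y, n)`. The chain leaves `c` at `(1, y + 1)` and enters `d` from `(n
    -- - y, n)`; one of these is not `b`. They coincide only for `y = n - 1`, where the Cartan entry
    -- is `-2`.
    by_cases hx : z = 1
    · exact ⟨(n - y, n), by simp only [Prod.mk.injEq, and_true]; split_ifs at this hcd <;> omega⟩
    · exact ⟨(1, y + 1), by simp only [Prod.mk.injEq, true_and]; split_ifs at this hcd <;> omega⟩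
  · rintro i hi ⟨x, y⟩ hb h2
    have := cart2 _ _ h2
    simp only [Prod.exists, Prod.forall, mem, hlab, Below] at *
    split_ifs at this
    · exact ⟨⟨1, n - 1, by omega, by simp; omega, by omega, fun _ _ _ _ ↦ by omega⟩,
        ⟨2, n, by omega, by simp; omega, by omega, fun _ _ _ _ ↦ by omega⟩⟩
    · omega
  · rintro i hi ⟨x, y⟩ hb h1
    have := cart1 _ _ h1
    simp only [mem_Icc, rank] at hi
    simp only [Prod.exists, Prod.forall, mem, hlab, Below] at *
    split_ifs at this with hx
    · rcases this.1 with h | h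
      · exact .inl ⟨1, y - 1, by omega, by simp; omega, by omega, fun _ _ _ _ ↦ by omega⟩
      · exact .inr (.inl ⟨1, y + 1, by omega, by simp; omega, by omega, fun _ _ _ _ ↦ by omega⟩)
    · rcases this.1 with h | h
      · exact .inr (.inl ⟨x + 1, n, by omega, by split_ifs <;> omega, by omega,
          fun _ _ _ _ ↦ by omega⟩)
      · exact .inl ⟨x - 1, n, by omega, by split_ifs <;> omega, by omega, fun _ _ _ _ ↦ by omega⟩

-- This is the heap of a half-spin representation.
set_option maxHeartbeats 1000000 in
theorem isHeap_DA (n : ℕ) (hn : 3 ≤ n) : (DA n hn).IsHeap := by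
  have mem (c : ℕ × ℕ) : c ∈ (DA n hn).boxes ↔ 1 ≤ c.1 ∧ c.1 ≤ c.2 ∧ c.2 + 1 ≤ n := by
    simp only [boxes, mem_filter, mem_product, mem_Icc]; omega
  have hlab (c : ℕ × ℕ) : (DA n hn).label c =
      if c.1 = c.2 then (if c.1 % 2 = 1 then n else n - 1) else n - 1 + c.1 - c.2 := by
    simp only [← Nat.odd_iff]; rfl
  have cases {x y : ℕ} (h : (x, y) ∈ (DA n hn).boxes) : 1 ≤ x ∧ y + 1 ≤ n ∧
      ((x = y ∧ n ≤ (DA n hn).label (x, y) + 1 ∧ (DA n hn).label (x, y) ≤ n) ∨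
        (x < y ∧ (DA n hn).label (x, y) + 1 + y = n + x)) := by
    rw [mem] at h
    simp only [hlab]
    split_ifs <;> omega
  have cart0 (i j : ℕ) (h : 0 ≤ (DA n hn).cartan i j) :
      ¬ ((i + 1 = j ∧ j < n) ∨ (j + 1 = i ∧ i < n) ∨ (i + 2 = j ∧ j = n) ∨
        (j + 2 = i ∧ i = n)) := by
    simp only [cartan] at h; split_ifs at h <;> omega
  have cart1 (i j : ℕ) (h : (DA n hn).cartan i j = -1) :
      (i + 1 = j ∧ j < n) ∨ (j + 1 = i ∧ i < n) ∨ (i + 2 = j ∧ j = n) ∨ (j + 2 = i ∧ i = n) := by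
    simp only [cartan] at h; split_ifs at h; omega
  have cart3 (i j : ℕ) (h : (DA n hn).cartan i j ≠ 0) : i = j ∨
      (i + 1 = j ∧ j < n) ∨ (j + 1 = i ∧ i < n) ∨ (i + 2 = j ∧ j = n) ∨ (j + 2 = i ∧ i = n) := by
    simp only [cartan] at h; split_ifs at h <;> omega
  refine isMinusculeHeap_of_labels _ _ (fun i ↦ by simp [cartan]) ?_ ?_ ?_ ?_ ?_ ?_ ?_
  · intro i j hij
    have hij' : (i : ℕ) ≠ j := Fin.val_ne_of_ne hij
    have hi : (i : ℕ) < n := i.2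
    have hj : (j : ℕ) < n := j.2
    have hM : (DA n hn).coxeterMatrix i j = if i = j then 1
      else if ((i : ℕ) + 1 = j ∧ (j : ℕ) + 1 < n) ∨ ((j : ℕ) + 1 = i ∧ (i : ℕ) + 1 < n) ∨
        ((i : ℕ) + 2 = j ∧ (j : ℕ) + 1 = n) ∨ ((j : ℕ) + 2 = i ∧ (i : ℕ) + 1 = n) then 3
      else 2 := rfl
    simp only [hM, if_neg hij, cartan]
    split_ifs <;> omega
  · refine ⟨?_, ?_, fun c hc ↦ ?_⟩
    · rw [mem]; omega
    · rw [hlab, omitted]; simp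
    · rw [mem] at hc; omega
  · rintro ⟨x, y⟩ hc ⟨z, w⟩ hb hcb h0
    have := cart0 _ _ h0
    have hc' := cases hc
    have hb' := cases hb
    generalize (DA n hn).label (x, y) = k at *
    generalize (DA n hn).label (z, w) = l at *
    simp only [mem, Below] at *
    by_cases hx : y < w
    · exact ⟨(x, y + 1), by dsimp only; omega⟩
    · exact ⟨(x + 1, y), by dsimp only; omega⟩
  · rintro ⟨x, y⟩ hc ⟨z, w⟩ hb h0
    have := cart3 _ _ h0
    have hc' := cases hc
    have hb' := cases hb
    generalize (DA n hn).label (x, y) = k at *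
    generalize (DA n hn).label (z, w) = l at *
    clear hc hb
    dsimp only
    omega
  · rintro ⟨x, y⟩ hc ⟨z, w⟩ hb hcb h1 ⟨x', y'⟩ hd hbd hcd
    have := cart1 _ _ h1
    simp only [mem, hlab, Below, ne_eq] at *
    by_cases hxy : x = y
    · have hb' : w = z + 1 := by
        rw [if_pos hxy] at this
        have hn : (if x % 2 = 1 then n else n - 1) = n ∨
            (if x % 2 = 1 then n else n - 1) = n - 1 := by
          split_ifs <;> simp
        generalize (if x % 2 = 1 then n else n - 1) = k at *
        split_ifs at this <;> omega
      have hd' : x' = y' := by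
        rw [if_pos hxy] at hcd
        split_ifs at hcd <;> omega
      -- Labels alternate between `n` and `n - 1` along the diagonal, so `d` is at least two
      -- diagonal places beyond `c`.
      have hne : x' ≠ x + 1 := by
        rintro rfl
        rw [if_pos hxy, if_pos hd'] at hcd
        split_ifs at hcd <;> omega
      by_cases hx : z = x
      · exact ⟨(x + 1, x + 1), by simp only [Prod.mk.injEq]; omega⟩
      · exact ⟨(x, x + 1), by simp only [Prod.mk.injEq]; omega⟩
    · rw [if_neg hxy] at hcd
      have hd' : x' + y = x + y' := by split_ifs at hcd <;> omega
      by_cases hx : z = x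
      · exact ⟨(x + 1, y), by simp only [Prod.mk.injEq]; omega⟩
      · exact ⟨(x, y + 1), by simp only [Prod.mk.injEq]; omega⟩
  · intro i _ b _ h2
    exfalso
    simp only [cartan] at h2; split_ifs at h2; omega
  · rintro i hi ⟨x, y⟩ hb h1
    have := cart1 _ _ h1
    simp only [mem_Icc, rank] at hi
    simp only [Prod.exists, Prod.forall, mem, hlab, Below] at *
    by_cases hxy : x = y
    · have hi' : i + 2 = n := by split_ifs at this <;> omega
      by_cases hx : x = 1
      · exact .inr (.inl ⟨x, x + 1, by omega, by split_ifs <;> omega, by omega,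
          fun _ _ _ _ ↦ by omega⟩)
      by_cases hy : x + 1 = n
      · exact .inl ⟨x - 1, x, by omega, by split_ifs <;> omega, by omega,
          fun _ _ _ _ ↦ by omega⟩
      · exact .inr (.inr ⟨x - 1, x, by omega, by split_ifs <;> omega, by omega, x, x + 1,
          by omega, by split_ifs <;> omega, by omega, fun _ _ _ _ _ _ _ _ ↦ by omega⟩)
    rw [if_neg hxy] at this
    -- Next to the diagonal, the label `n` or `n - 1` occurs at exactly one of the diagonal
    -- neighbours `(x, x)` and `(y, y)`; the parity of `x` decides which.
    by_cases hk : y = x + 1 ∧ n ≤ i + 1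
    · by_cases hc : x % 2 = 1 ↔ i = n
      · exact .inl ⟨x, x, by omega, by split_ifs <;> omega, by omega, fun _ _ _ _ ↦ by omega⟩
      · exact .inr (.inl ⟨y, y, by omega, by split_ifs <;> omega, by omega,
          fun _ _ _ _ ↦ by omega⟩)
    by_cases hlt : i + y < n - 1 + x
    · by_cases hx : x = 1
      · exact .inr (.inl ⟨x, y + 1, by omega, by split_ifs <;> omega, by omega,
          fun _ _ _ _ ↦ by omega⟩)
      by_cases hy : y + 1 = n
      · exact .inl ⟨x - 1, y, by omega, by split_ifs <;> omega, by omega, fun _ _ _ _ ↦ by omega⟩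
      · exact .inr (.inr ⟨x - 1, y, by omega, by split_ifs <;> omega, by omega, x, y + 1,
          by omega, by split_ifs <;> omega, by omega, fun _ _ _ _ _ _ _ _ ↦ by omega⟩)
    · exact .inr (.inr ⟨x, y - 1, by omega, by split_ifs <;> omega, by omega, x + 1, y, by omega,
        by split_ifs <;> omega, by omega, fun _ _ _ _ _ _ _ _ ↦ by omega⟩)

-- This is the heap of the `2n`-dimensional vector representation: a chain except for two
-- incomparable middle boxes, labelled `n` and `n - 1`.
set_option maxHeartbeats 1000000 in
theorem isHeap_DD (n : ℕ) (hn : 3 ≤ n) : (DD n hn).IsHeap := by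
  have mem (c : ℕ × ℕ) : c ∈ (DD n hn).boxes ↔ (c.1 = 1 ∧ 1 ≤ c.2 ∧ c.2 + 1 ≤ n) ∨
      (c.1 = 2 ∧ c.2 + 2 = n) ∨ (2 ≤ c.1 ∧ c.1 + 1 ≤ n ∧ c.2 + 1 = n) := by
    simp only [boxes, mem_union, mem_product, mem_Icc, mem_singleton]; omega
  have hlab (c : ℕ × ℕ) : (DD n hn).label c = if c.1 = 1 then (if c.2 = n - 1 then n else c.2)
      else if c.1 = 2 ∧ c.2 = n - 2 then n - 1 else n - c.1 := rfl
  have cases {x y : ℕ} (h : (x, y) ∈ (DD n hn).boxes) :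
      (x = 1 ∧ 1 ≤ y ∧ y + 2 ≤ n ∧ (DD n hn).label (x, y) = y) ∨
      (x = 1 ∧ y + 1 = n ∧ (DD n hn).label (x, y) = n) ∨
      (x = 2 ∧ y + 2 = n ∧ (DD n hn).label (x, y) + 1 = n) ∨
      (2 ≤ x ∧ x + 1 ≤ n ∧ y + 1 = n ∧ (DD n hn).label (x, y) + x = n) := by
    rw [mem] at h
    simp only [hlab]
    split_ifs <;> omega
  have cart0 (i j : ℕ) (h : 0 ≤ (DD n hn).cartan i j) :
      ¬ ((i + 1 = j ∧ j < n) ∨ (j + 1 = i ∧ i < n) ∨ (i + 2 = j ∧ j = n) ∨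
        (j + 2 = i ∧ i = n)) := by
    simp only [cartan] at h; split_ifs at h <;> omega
  have cart1 (i j : ℕ) (h : (DD n hn).cartan i j = -1) :
      (i + 1 = j ∧ j < n) ∨ (j + 1 = i ∧ i < n) ∨ (i + 2 = j ∧ j = n) ∨ (j + 2 = i ∧ i = n) := by
    simp only [cartan] at h; split_ifs at h; omega
  have cart3 (i j : ℕ) (h : (DD n hn).cartan i j ≠ 0) : i = j ∨
      (i + 1 = j ∧ j < n) ∨ (j + 1 = i ∧ i < n) ∨ (i + 2 = j ∧ j = n) ∨ (j + 2 = i ∧ i = n) := by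
    simp only [cartan] at h; split_ifs at h <;> omega
  refine isMinusculeHeap_of_labels _ _ (fun i ↦ by simp [cartan]) ?_ ?_ ?_ ?_ ?_ ?_ ?_
  · intro i j hij
    have hij' : (i : ℕ) ≠ j := Fin.val_ne_of_ne hij
    have hi : (i : ℕ) < n := i.2
    have hj : (j : ℕ) < n := j.2
    have hM : (DD n hn).coxeterMatrix i j = if i = j then 1
      else if ((i : ℕ) + 1 = j ∧ (j : ℕ) + 1 < n) ∨ ((j : ℕ) + 1 = i ∧ (i : ℕ) + 1 < n) ∨
        ((i : ℕ) + 2 = j ∧ (j : ℕ) + 1 = n) ∨ ((j : ℕ) + 2 = i ∧ (i : ℕ) + 1 = n) then 3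
      else 2 := rfl
    simp only [hM, if_neg hij, cartan]
    split_ifs <;> omega
  · refine ⟨?_, ?_, fun c hc ↦ ?_⟩
    · rw [mem]; omega
    · rw [hlab, omitted]; split_ifs <;> omega
    · rw [mem] at hc; omega
  · rintro ⟨x, y⟩ hc ⟨z, w⟩ hb hcb h0
    have := cart0 _ _ h0
    have hc' := cases hc
    have hb' := cases hb
    generalize (DD n hn).label (x, y) = k at *
    generalize (DD n hn).label (z, w) = l at *
    clear hc hb
    simp only [mem, Below] at *
    rcases hc' with hc' | hc' | hc' | hc'
    · exact ⟨(1, y + 1), by simp only [true_and]; omega⟩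
    · exact ⟨(2, n - 1), by simp only [true_and]; omega⟩
    · exact ⟨(2, n - 1), by simp only [true_and]; omega⟩
    · exact ⟨(x + 1, n - 1), by dsimp only; omega⟩
  · rintro ⟨x, y⟩ hc ⟨z, w⟩ hb h0
    have := cart3 _ _ h0
    have hc' := cases hc
    have hb' := cases hb
    generalize (DD n hn).label (x, y) = k at *
    generalize (DD n hn).label (z, w) = l at *
    clear hc hb
    dsimp only
    omega
  · rintro ⟨x, y⟩ hc ⟨z, w⟩ hb hcb h1 ⟨x', y'⟩ hd hbd hcd
    have hc' := cases hc
    have hd' := cases hd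
    generalize (DD n hn).label (x, y) = k at *
    generalize (DD n hn).label (x', y') = l at *
    clear hc hd h1
    simp only [mem, Below, ne_eq] at *
    have hcx : x = 1 ∧ y + 2 ≤ n ∧ 2 ≤ x' ∧ y' + 1 = n := by omega
    clear hc' hd' hcd
    -- Both middle boxes lie between `c` and `d`; take one that is not `b`.
    by_cases hx : z = 1 ∧ w + 1 = n
    · exact ⟨(2, n - 2), by simp only [Prod.mk.injEq, true_and]; omega⟩
    · exact ⟨(1, n - 1), by simp only [Prod.mk.injEq, true_and]; omega⟩
  · intro i _ b _ h2
    exfalso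
    simp only [cartan] at h2; split_ifs at h2; omega
  · rintro i hi ⟨x, y⟩ hb h1
    have := cart1 _ _ h1
    simp only [mem_Icc, rank] at hi
    simp only [Prod.exists, Prod.forall, mem, hlab, Below] at *
    -- The equation singles out the two middle boxes, whose only adjacent label `n - 2` occurs just
    -- below and just above them in the order.
    by_cases hmid : x + y = n
    · have hi' : i + 2 = n := by split_ifs at this <;> omega
      exact .inr (.inr ⟨1, n - 2, by omega, by split_ifs <;> omega, by omega, 2, n - 1,
        by omega, by split_ifs <;> omega, by omega, fun _ _ _ _ _ _ _ _ ↦ by omega⟩)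
    by_cases hx : x = 1
    · have hy : y + 1 < n := by omega
      rw [if_pos hx, if_neg (by omega)] at this
      by_cases hlt : i < y
      · exact .inl ⟨1, y - 1, by omega, by split_ifs <;> omega, by omega, fun _ _ _ _ ↦ by omega⟩
      by_cases hin : i + 1 = n
      · exact .inr (.inl ⟨2, n - 2, by omega, by split_ifs <;> omega, by omega,
          fun _ _ _ _ ↦ by omega⟩)
      · exact .inr (.inl ⟨1, y + 1, by omega, by split_ifs <;> omega, by omega,
          fun _ _ _ _ ↦ by omega⟩)
    · rw [if_neg hx, if_neg (by omega)] at this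
      by_cases hlt : i < n - x
      · exact .inr (.inl ⟨x + 1, n - 1, by omega, by split_ifs <;> omega, by omega,
          fun _ _ _ _ ↦ by omega⟩)
      by_cases hin : i + 1 = n
      · exact .inl ⟨2, n - 2, by omega, by split_ifs <;> omega, by omega, fun _ _ _ _ ↦ by omega⟩
      · exact .inl ⟨x - 1, n - 1, by omega, by split_ifs <;> omega, by omega,
          fun _ _ _ _ ↦ by omega⟩

theorem isHeap : ∀ T : HermitianPair, T.IsHeap
  | A n p hp hpn => isHeap_A n p hp hpn
  | C n hn => isHeap_C n hn
  | B n hn => isHeap_B n hn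
  | DA n hn => isHeap_DA n hn
  | DD n hn => isHeap_DD n hn
  | E6 => isHeap_E6
  | E7 => isHeap_E7

end HermitianPair

/-! ### The main theorem -/

theorem mainTheorem5 (T : HermitianPair) {W : Type*} [Group W]
    (cs : CoxeterSystem T.coxeterMatrix W) :
    ∃ e : T.Subdiagram ≃ cs.minimalReps T.J,
      (∀ L : T.Subdiagram, (e L : W) = T.elementOf cs L.1) ∧
      (∀ L K : T.Subdiagram, L ≤ K ↔ cs.LeftWeakLE (e L : W) (e K : W)) ∧
      (∀ u v : cs.minimalReps T.J,
        cs.BruhatLE (u : W) (v : W) ↔ (e.symm u).1 ⊆ (e.symm v).1) := by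
  have h := T.isHeap
  have hw := T.isReading_rowWord
  -- Subdiagrams are by definition the order ideals of `T.boxes`, and `T.J` is the complement of the
  -- label of the smallest box.
  let e : T.Subdiagram ≃ cs.minimalReps T.J := h.elemEquiv cs hw
  have he (u : cs.minimalReps T.J) : (u : W) = T.elementOf cs (e.symm u).1 :=
    congrArg Subtype.val (e.apply_symm_apply u).symm
  refine ⟨e, fun L ↦ rfl, fun L K ↦ h.subset_iff_leftWeakLE cs hw L.1 K.1 L.2 K.2, fun u v ↦ ?_⟩
  rw [he u, he v]
  exact (h.subset_iff_bruhatLE cs hw _ _ (e.symm u).2 (e.symm v).2).symm
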